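/- **Setting.** Let $\mathbf A$ be a finite alphabet and $\mathcal B\subset\mathbf A^2$ a transition set such that the subshift of finite type $\Sigma=\{(a_i)\in\mathbf A^{\mathbb Z} : (a_i,a_{i+1})\in\mathcal B\ \forall i\}$ is topologically mixing and uses all letters of $\mathbf A$. Put $I(a)=[0,1]\times\{a\}$ for $a\in\mathbf A$. Let $r\in(1,+\infty]$ and let $g$ be a $C^r$ expanding map of type $\Sigma$: its domain is a disjoint union $\bigsqcup_{(a_0,a_1)\in\mathcal B} I(a_0,a_1)$ of compact intervals $I(a_0,a_1)\subset I(a_0)$, and each restriction $g|_{I(a_0,a_1)}$ is a $C^r$-diffeomorphism onto $I(a_1)$ with $|Dg|>1$ (for non-integer $r$, $C^r$ means $C^{\lfloor r\rfloor}$ with $(r-\lfloor r\rfloor)$-Hölder derivative of order $\lfloor r\rfloor$). The associated regular Cantor set is $K=\bigcap_{n\ge0}g^{-n}\bigl(\bigsqcup_{\mathcal B} I(a_0,a_1)\bigr)$. A word is a non-empty finite sequence $\underline c=(c_0,\dots,c_n)$ with $(c_i,c_{i+1})\in\mathcal B$ for all $i<n$; writing $f_{(a_0,a_1)}=(g|_{I(a_0,a_1)})^{-1}$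 and $f_{\underline c}=f_{(c_0,c_1)}\circ\dots\circ f_{(c_{n-1},c_n)}$ (the identity if $n=0$), put $I(\underline c)=f_{\underline c}(I(c_n))\subset I(c_0)$. Let $K'$ be a second regular Cantor set, with data $\mathbf A',\mathcal B',r',g',I'$ of the same kind. Fix a constant $\kappa>1$, letters $a\in\mathbf A$, $a'\in\mathbf A'$ and $C^1$-embeddings $h:I(a)\to\mathbb R$, $h':I'(a')\to\mathbb R$ (so that $\tilde K=h(K\cap I(a))$ and $\tilde K'=h'(K'\cap I'(a'))$ are differentiable embeddings of $K$, $K'$). For $\rho\in(0,1)$ let $\tilde\Sigma(\rho)$ be the set of words $\underline c$ beginning with $a$ such that $\kappa^{-1}\rho\le|I(\underline c)|\le \kappa\rho$, and define $\tilde\Sigma'(\rho)$ analogously with $a'$. The $\rho$-rectangles of $\tilde K\times\tilde K'$ are the sets $h(I(\underline c))\times h'(I'(\underline c'))$ with $(\underline c,\underline c')\in\tilde\Sigma(\rho)\times\tilde\Sigma'(\rho)$; let $\mathcal R(\rho)$ be the set of them, indexed by these pairs of words. For $s\in\mathbb R$ let $\pi_s(x,y)=x-sy$ and $$N_\rho(s)=\#\{(Q,\tilde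 Q)\in\mathcal R(\rho)\times\mathcal R(\rho) : \pi_s(Q)\cap\pi_s(\tilde Q)\neq\emptyset\}.$$ **Proposition 1.** Let $d$ and $d'$ be the Hausdorff dimensions of $K$ and $K'$, and suppose that $d+d'<1$. Then for every $R>0$ there is a constant $C$ (independent of $\rho$) such that, for every $\rho\in(0,1)$, $N_\rho$ is finite-valued and integrable on $[-R,R]$, and $$\int_{-R}^{R}N_\rho(\lambda)\,d\lambda\le C\,\rho^{-d-d'}.$$ -/

import Mathlib

open Set MeasureTheory
open scoped NNReal ENNReal

noncomputable section

namespace RegularCantor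

/-! ### Subshifts of finite type -/

/-- The bilateral subshift of finite type `Σ ⊆ A^ℤ` with transition set `B`. -/
def subshift {A : Type*} (B : A → A → Prop) : Set (ℤ → A) :=
  {x | ∀ i : ℤ, B (x i) (x (i + 1))}

/-- The shift `σ` iterated `n` times, `(σⁿ x)ᵢ = xᵢ₊ₙ`. -/
def shift {A : Type*} (n : ℕ) (x : ℤ → A) : ℤ → A := fun i => x (i + n)

/-- The subshift is topologically mixing: `A` carries the discrete topology, `A^ℤ` the product
topology, and for any two relatively open non-empty subsets `U ∩ Σ`, `V ∩ Σ`, the set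
`σⁿ(U ∩ Σ) ∩ V` is non-empty for all large `n`. -/
def IsMixing {A : Type*} (B : A → A → Prop) : Prop :=
  letI : TopologicalSpace A := ⊥
  ∀ U V : Set (ℤ → A), IsOpen U → IsOpen V →
    (U ∩ subshift B).Nonempty → (V ∩ subshift B).Nonempty →
    ∃ N : ℕ, ∀ n ≥ N, ∃ x ∈ U ∩ subshift B, shift n x ∈ V

/-- Every letter of `A` occurs in some element of the subshift. -/
def UsesAllLetters {A : Type*} (B : A → A → Prop) : Prop :=
  ∀ a : A, ∃ x ∈ subshift B, ∃ i : ℤ, x i = a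

/-! ### Smoothness of real order -/

/-- `f` is of class `C^r` on `s`, for `r ∈ [0, ∞]`: smooth if `r = ∞`; otherwise `f` is `C^k` with
`k = ⌊r⌋` and its `k`-th derivative is Hölder of exponent `r - k` (when `r = k` the exponent is `0`,
and on a compact set the Hölder condition is void). -/
def IsCr (r : ℝ≥0∞) (f : ℝ → ℝ) (s : Set ℝ) : Prop :=
  if r = ⊤ then ContDiffOn ℝ ((⊤ : ℕ∞) : WithTop ℕ∞) f s
  else ContDiffOn ℝ (⌊r.toNNReal⌋₊ : WithTop ℕ∞) f s ∧
    ∃ C : ℝ≥0, HolderOnWith C (r.toNNReal - (⌊r.toNNReal⌋₊ : ℝ≥0))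
      (iteratedDerivWithin ⌊r.toNNReal⌋₊ f s) s

/-! ### Expanding maps and regular Cantor sets

The disjoint union of the lines `ℝ × {a}`, `a ∈ A`, is the sigma type `(_ : A) × ℝ`; the interval
`I(a)` is the copy of `[0,1]` over `a`. -/

/-- A `C^r` expanding map of type `Σ`, where `Σ` is given by the transition set `B`. The map `g` is
only relevant on its domain, the union of the intervals `I(a, b) = [lo a b, hi a b]` over `a`, with
`(a, b) ∈ B`. -/
structure ExpandingMap {A : Type*} (B : A → A → Prop) (r : ℝ≥0∞) where
  lo : A → A → ℝ
  hi : A → A → ℝ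
  g : (_ : A) × ℝ → (_ : A) × ℝ
  subset_unit : ∀ a b, B a b → Icc (lo a b) (hi a b) ⊆ Icc 0 1
  disjoint : ∀ a b c, B a b → B a c → b ≠ c →
    Disjoint (Icc (lo a b) (hi a b)) (Icc (lo a c) (hi a c))
  maps_fst : ∀ a b, B a b → ∀ t ∈ Icc (lo a b) (hi a b), (g ⟨a, t⟩).1 = b
  bijOn : ∀ a b, B a b → BijOn (fun t => (g ⟨a, t⟩).2) (Icc (lo a b) (hi a b)) (Icc 0 1)
  smooth : ∀ a b, B a b → IsCr r (fun t => (g ⟨a, t⟩).2) (Icc (lo a b) (hi a b))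
  expanding : ∀ a b, B a b → ∀ t ∈ Icc (lo a b) (hi a b),
    1 < |derivWithin (fun t => (g ⟨a, t⟩).2) (Icc (lo a b) (hi a b)) t|

namespace ExpandingMap

variable {A : Type*} {B : A → A → Prop} {r : ℝ≥0∞}

/-- The interval `I(a, b)`, as a subset of `[0,1]`. -/
def I₂ (G : ExpandingMap B r) (a b : A) : Set ℝ := Icc (G.lo a b) (G.hi a b)

/-- The domain of the expanding map. -/
def domain (G : ExpandingMap B r) : Set ((_ : A) × ℝ) :=
  {p | ∃ b, B p.1 b ∧ p.2 ∈ G.I₂ p.1 b}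

/-- The regular Cantor set `K = ⋂ₙ g⁻ⁿ(domain)`. -/
def K (G : ExpandingMap B r) : Set ((_ : A) × ℝ) :=
  ⋂ n : ℕ, G.g^[n] ⁻¹' G.domain

/-- The Hausdorff dimension of `K`. The disjoint union of the lines carries Mathlib's metric, which
is the usual distance on each line and is at least `1` between distinct lines. -/
def HD (G : ExpandingMap B r) : ℝ≥0∞ :=
  letI : MetricSpace ((_ : A) × ℝ) := Metric.Sigma.metricSpace
  dimH G.K

/-- The inverse branch `f_{(a,b)} : [0,1] → I(a, b)`. -/
def branch (G : ExpandingMap B r) (a b : A) : ℝ → ℝ :=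
  Function.invFunOn (fun t => (G.g ⟨a, t⟩).2) (G.I₂ a b)

/-- `f_{(a₀,…,aₙ)} = f_{(a₀,a₁)} ∘ ⋯ ∘ f_{(aₙ₋₁,aₙ)}`; the identity for a word of length one. -/
def wordMap (G : ExpandingMap B r) : List A → ℝ → ℝ
  | a :: b :: w => G.branch a b ∘ wordMap G (b :: w)
  | _ => id

/-- The interval `I(c)` of a word `c`, as a subset of `[0,1]`. -/
def wordInterval (G : ExpandingMap B r) (c : List A) : Set ℝ := G.wordMap c '' Icc 0 1

/-- The words `c` that begin by `a`, obey the transition rules, and satisfy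
`c₀⁻¹ ρ ≤ |I(c)| ≤ c₀ ρ`. -/
def words (G : ExpandingMap B r) (c₀ : ℝ) (a : A) (ρ : ℝ) : Set (List A) :=
  {c | c.IsChain B ∧ c.head? = some a ∧
    c₀⁻¹ * ρ ≤ Metric.diam (G.wordInterval c) ∧ Metric.diam (G.wordInterval c) ≤ c₀ * ρ}

end ExpandingMap

/-- `h` restricts to a `C¹` embedding of `[0,1]` into `ℝ`. -/
structure IsC1Embedding (h : ℝ → ℝ) : Prop where
  contDiffOn : ContDiffOn ℝ 1 h (Icc 0 1)
  injOn : InjOn h (Icc 0 1)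
  deriv_ne_zero : ∀ t ∈ Icc (0 : ℝ) 1, derivWithin h (Icc 0 1) t ≠ 0

/-- `π_s(x, y) = x - s y`. -/
def proj (s : ℝ) (p : ℝ × ℝ) : ℝ := p.1 - s * p.2

section Rectangles

variable {A A' : Type*} {B : A → A → Prop} {B' : A' → A' → Prop} {r r' : ℝ≥0∞}

/-- The rectangle `h(I(c)) × h'(I'(c'))` of a pair of words `(c, c')`. -/
def rect (G : ExpandingMap B r) (G' : ExpandingMap B' r') (h h' : ℝ → ℝ)
    (q : List A × List A') : Set (ℝ × ℝ) :=
  (h '' G.wordInterval q.1) ×ˢ (h' '' G'.wordInterval q.2)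

/-- The set of `ρ`-rectangles, indexed by pairs of words beginning by `a`, `a'`. -/
def rectangles (G : ExpandingMap B r) (G' : ExpandingMap B' r') (c₀ : ℝ) (a : A) (a' : A')
    (ρ : ℝ) : Set (List A × List A') :=
  G.words c₀ a ρ ×ˢ G'.words c₀ a' ρ

/-- The pairs of `ρ`-rectangles whose images by `π_s` intersect. -/
def overlaps (G : ExpandingMap B r) (G' : ExpandingMap B' r') (c₀ : ℝ) (a : A) (a' : A')
    (h h' : ℝ → ℝ) (ρ s : ℝ) : Set ((List A × List A') × (List A × List A')) :=
  {p | p.1 ∈ rectangles G G' c₀ a a' ρ ∧ p.2 ∈ rectangles G G' c₀ a a' ρ ∧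
    (proj s '' rect G G' h h' p.1 ∩ proj s '' rect G G' h h' p.2).Nonempty}

/-- `N_ρ(s)`, the number of pairs of `ρ`-rectangles whose images by `π_s` intersect. -/
def N (G : ExpandingMap B r) (G' : ExpandingMap B' r') (c₀ : ℝ) (a : A) (a' : A')
    (h h' : ℝ → ℝ) (ρ s : ℝ) : ℕ :=
  (overlaps G G' c₀ a a' h h' ρ s).ncard

end Rectangles

end RegularCantor

end

/-! Fix a letter `b`. A finite prefix-free set of loops at `b` gives an iterated function system
whose limit set lies over `b` in `K`. If it has `m` maps, each shrinking distances at most by the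
factor `s`, that limit set has dimension at least `log m / log s`, so `m ≤ s ^ d`. Consider now the
words of length about `ρ` whose intervals lie within `τ` of a given one. They form boundedly many
prefix-free families; by bounded distortion the interval of their longest common prefix has length
`≲ τ`. Removing that prefix and completing what remains to loops shows that there are at most
`C (τ / ρ) ^ d` of them.

Let `(u, v)` be the difference of base points of two `ρ`-rectangles. Their projections by `π_s`
meet only if `|u - s v| ≤ E ρ`. In `[-R, R]` these `s` form a set of measure `≲ min 1 (ρ / |v|)`,
which is empty unless `|u| ≲ ρ + |v|`. Hence the pairs with `max ρ |v| ≈ 2 ^ k ρ` number at most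
`ρ ^ (-d - d') 2 ^ (k (d + d'))` up to a constant and contribute at most `2 ^ (-k)` each. Because
`d + d' < 1`, the sum over `k` is a convergent geometric series. -/

namespace RegularCantor

theorem exists_mem_uIcc_sub_eq_derivWithin_mul {f : ℝ → ℝ} {lo hi : ℝ}
    (hf : DifferentiableOn ℝ f (Icc lo hi)) {u v : ℝ} (hu : u ∈ Icc lo hi) (hv : v ∈ Icc lo hi) :
    ∃ ξ ∈ uIcc u v, f v - f u = derivWithin f (Icc lo hi) ξ * (v - u) := by
  wlog huv : u ≤ v generalizing u v
  · obtain ⟨ξ, hξ, h⟩ := this hv hu (le_of_not_ge huv)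
    exact ⟨ξ, uIcc_comm u v ▸ hξ, by linarith⟩
  rcases huv.eq_or_lt with rfl | huv
  · exact ⟨u, left_mem_uIcc, by simp only [sub_self, mul_zero]⟩
  have hsub : Icc u v ⊆ Icc lo hi := Icc_subset_Icc hu.1 hv.2
  obtain ⟨ξ, hξ, h⟩ := exists_hasDerivAt_eq_slope f (derivWithin f (Icc lo hi)) huv
    (hf.continuousOn.mono hsub) fun x hx =>
      (hf x (hsub (Ioo_subset_Icc_self hx))).hasDerivWithinAt.hasDerivAt
        (Icc_mem_nhds (hu.1.trans_lt hx.1) (hx.2.trans_le hv.2))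
  refine ⟨ξ, Icc_subset_uIcc (Ioo_subset_Icc_self hξ), ?_⟩
  rw [h, div_mul_cancel₀ _ (sub_pos.2 huv).ne']

theorem exists_lt_forall_mul_abs_sub_le {f : ℝ → ℝ} {lo hi : ℝ} (hlt : lo < hi)
    (hf : ContDiffOn ℝ 1 f (Icc lo hi)) {t : ℝ}
    (ht : ∀ x ∈ Icc lo hi, t < |derivWithin f (Icc lo hi) x|) :
    ∃ m > t, ∀ x ∈ Icc lo hi, ∀ y ∈ Icc lo hi, m * |x - y| ≤ |f x - f y| := by
  obtain ⟨z, hz, hmin⟩ := isCompact_Icc.exists_isMinOn (nonempty_Icc.2 hlt.le)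
    (hf.continuousOn_derivWithin (uniqueDiffOn_Icc hlt) le_rfl).abs
  refine ⟨_, ht z hz, fun x hx y hy => ?_⟩
  obtain ⟨ξ, hξ, h⟩ :=
    exists_mem_uIcc_sub_eq_derivWithin_mul (hf.differentiableOn one_ne_zero) hy hx
  rw [h, abs_mul]
  exact mul_le_mul_of_nonneg_right (hmin (ordConnected_Icc.uIcc_subset hy hx hξ)) (abs_nonneg _)

theorem IsCr.contDiffOn_one {r : ℝ≥0∞} (hr : 1 < r) {f : ℝ → ℝ} {s : Set ℝ} (hf : IsCr r f s) :
    ContDiffOn ℝ 1 f s := by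
  unfold IsCr at hf
  split_ifs at hf with hr'
  · exact hf.of_le (by exact_mod_cast le_top)
  · have : 1 ≤ ⌊r.toNNReal⌋₊ := by
      apply Nat.le_floor
      rw [← ENNReal.coe_le_coe, ENNReal.coe_toNNReal hr']
      simpa only [Nat.cast_one, ENNReal.coe_one] using hr.le
    exact hf.1.of_le (by exact_mod_cast this)

theorem exists_holderOnWith_one_derivWithin {f : ℝ → ℝ} {lo hi : ℝ} (hlt : lo < hi)
    (hf : ContDiffOn ℝ 2 f (Icc lo hi)) :
    ∃ H, HolderOnWith H 1 (derivWithin f (Icc lo hi)) (Icc lo hi) := by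
  obtain ⟨H, hH⟩ := (hf.derivWithin (uniqueDiffOn_Icc hlt) (m := 1)
    (by norm_num)).exists_lipschitzOnWith one_ne_zero (convex_Icc lo hi) isCompact_Icc
  exact ⟨H, hH.holderOnWith⟩

theorem exists_holderOnWith_derivWithin_of_isCr {r : ℝ≥0∞} (hr : 1 < r) :
    ∃ α : ℝ≥0, 0 < α ∧ ∀ (f : ℝ → ℝ) (lo hi : ℝ), lo < hi → IsCr r f (Icc lo hi) →
      ∃ H, HolderOnWith H α (derivWithin f (Icc lo hi)) (Icc lo hi) := by
  by_cases hr' : r = ⊤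
  · refine ⟨1, one_pos, fun f lo hi hlt hf => ?_⟩
    rw [IsCr, if_pos hr'] at hf
    exact exists_holderOnWith_one_derivWithin hlt
      (hf.of_le (WithTop.coe_le_coe.2 (le_top : (2 : ℕ∞) ≤ ⊤)))
  have h1 : 1 < r.toNNReal := by
    rwa [← ENNReal.coe_lt_coe, ENNReal.coe_toNNReal hr', ENNReal.coe_one]
  rcases (Nat.le_floor (by simpa using h1.le) : 1 ≤ ⌊r.toNNReal⌋₊).eq_or_lt with hk | hk
  · refine ⟨r.toNNReal - 1, tsub_pos_of_lt h1, fun f lo hi _ hf => ?_⟩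
    rw [IsCr, if_neg hr', ← hk, Nat.cast_one] at hf
    obtain ⟨-, H, hH⟩ := hf
    rw [iteratedDerivWithin_one] at hH
    exact ⟨H, by exact_mod_cast hH⟩
  · refine ⟨1, one_pos, fun f lo hi hlt hf => ?_⟩
    rw [IsCr, if_neg hr'] at hf
    exact exists_holderOnWith_one_derivWithin hlt (hf.1.of_le (by exact_mod_cast hk))

/-- `f` has distortion at most `D` on `s`: it changes ratios of distances by at most the factor
`D`. The ratios are cleared of denominators, so that no points need to be distinct. -/
def DistortionOnWith {X Z : Type*} [PseudoMetricSpace X] [PseudoMetricSpace Z] (D : ℝ)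
    (f : X → Z) (s : Set X) : Prop :=
  ∀ x ∈ s, ∀ y ∈ s, ∀ z ∈ s, ∀ w ∈ s,
    dist (f x) (f y) * dist z w ≤ D * (dist (f z) (f w) * dist x y)

section Distortion

variable {X Y Z : Type*} [PseudoMetricSpace X] [MetricSpace Y] [PseudoMetricSpace Z]

theorem distortionOnWith_id (s : Set X) : DistortionOnWith 1 id s := fun x _ y _ z _ w _ => by
  rw [id, id, id, id, one_mul, mul_comm]

theorem DistortionOnWith.mono_const {D E : ℝ} {f : X → Z} {s : Set X}
    (hf : DistortionOnWith D f s) (hDE : D ≤ E) : DistortionOnWith E f s :=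
  fun x hx y hy z hz w hw => (hf x hx y hy z hz w hw).trans (by gcongr)

theorem DistortionOnWith.of_leftInvOn {D : ℝ} {f : X → Z} {g : Z → X} {s : Set Z} {t : Set X}
    (hf : DistortionOnWith D f t) (hg : MapsTo g s t) (hfg : LeftInvOn f g s) :
    DistortionOnWith D g s := fun x hx y hy z hz w hw => by
  have h := hf _ (hg hz) _ (hg hw) _ (hg hx) _ (hg hy)
  rwa [hfg hx, hfg hy, hfg hz, hfg hw, mul_comm (dist z w), mul_comm (dist x y)] at h

theorem DistortionOnWith.comp {D E : ℝ} {g : Y → Z} {f : X → Y} {s : Set X} {t : Set Y}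
    (hg : DistortionOnWith D g t) (hf : DistortionOnWith E f s) (hst : MapsTo f s t)
    (hD : 0 ≤ D) : DistortionOnWith (D * E) (g ∘ f) s := by
  intro x hx y hy z hz w hw
  have hfxy := hf x hx y hy z hz w hw
  rcases dist_nonneg.eq_or_lt' (a := dist (f z) (f w)) with hzw | hzw
  · rw [hzw, zero_mul, mul_zero] at hfxy
    have hgxy : dist (g (f x)) (g (f y)) * dist z w = 0 := by
      rcases mul_eq_zero.1 (hfxy.antisymm (by positivity)) with h | h
      · rw [dist_eq_zero.1 h, dist_self, zero_mul]
      · rw [h, mul_zero]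
    simp only [Function.comp_apply, hgxy, dist_eq_zero.1 hzw, dist_self, zero_mul, mul_zero,
      le_refl]
  refine le_of_mul_le_mul_right ?_ hzw
  calc dist (g (f x)) (g (f y)) * dist z w * dist (f z) (f w)
      = dist (g (f x)) (g (f y)) * dist (f z) (f w) * dist z w := by ring
    _ ≤ D * (dist (g (f z)) (g (f w)) * dist (f x) (f y)) * dist z w := by
        gcongr ?_ * _
        exact hg _ (hst hx) _ (hst hy) _ (hst hz) _ (hst hw)
    _ = D * dist (g (f z)) (g (f w)) * (dist (f x) (f y) * dist z w) := by ring
    _ ≤ D * dist (g (f z)) (g (f w)) * (E * (dist (f z) (f w) * dist x y)) := by gcongr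
    _ = D * E * (dist (g (f z)) (g (f w)) * dist x y) * dist (f z) (f w) := by ring

end Distortion

theorem abs_derivWithin_le_exp_mul {f : ℝ → ℝ} {lo hi δ : ℝ} {s : Set ℝ} {H α : ℝ≥0}
    (hexp : ∀ t ∈ s, 1 ≤ |derivWithin f (Icc lo hi) t|)
    (hH : HolderOnWith H α (derivWithin f (Icc lo hi)) s) {x y : ℝ} (hx : x ∈ s) (hy : y ∈ s)
    (hδ : dist x y ≤ δ) :
    |derivWithin f (Icc lo hi) x| ≤
      Real.exp (H * δ ^ (α : ℝ)) * |derivWithin f (Icc lo hi) y| := by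
  set P := derivWithin f (Icc lo hi) x
  set Q := derivWithin f (Icc lo hi) y
  have hPQ : |P - Q| ≤ H * δ ^ (α : ℝ) := (hH.dist_le hx hy).trans (by gcongr)
  have hQ : H * δ ^ (α : ℝ) ≤ H * δ ^ (α : ℝ) * |Q| :=
    le_mul_of_one_le_right ((abs_nonneg _).trans hPQ) (hexp y hy)
  calc |P| ≤ |P - Q| + |Q| := by linarith [abs_sub_abs_le_abs_sub P Q]
    _ ≤ (H * δ ^ (α : ℝ) + 1) * |Q| := by linarith
    _ ≤ Real.exp (H * δ ^ (α : ℝ)) * |Q| := by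
        gcongr
        exact Real.add_one_le_exp _

theorem distortionOnWith_exp_of_holderOnWith {f : ℝ → ℝ} {lo hi δ : ℝ} {s : Set ℝ} {H α : ℝ≥0}
    (hf : DifferentiableOn ℝ f (Icc lo hi)) (hs : s ⊆ Icc lo hi) [hconn : OrdConnected s]
    (hexp : ∀ t ∈ s, 1 ≤ |derivWithin f (Icc lo hi) t|)
    (hH : HolderOnWith H α (derivWithin f (Icc lo hi)) s)
    (hδ : ∀ x ∈ s, ∀ y ∈ s, dist x y ≤ δ) :
    DistortionOnWith (Real.exp (H * δ ^ (α : ℝ))) f s := by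
  intro x hx y hy z hz w hw
  obtain ⟨ξ, hξ, hxy⟩ := exists_mem_uIcc_sub_eq_derivWithin_mul hf (hs hy) (hs hx)
  obtain ⟨ζ, hζ, hzw⟩ := exists_mem_uIcc_sub_eq_derivWithin_mul hf (hs hw) (hs hz)
  have hξs : ξ ∈ s := hconn.uIcc_subset hy hx hξ
  have hζs : ζ ∈ s := hconn.uIcc_subset hw hz hζ
  have hξζ := abs_derivWithin_le_exp_mul hexp hH hξs hζs (hδ ξ hξs ζ hζs)
  simp only [Real.dist_eq, hxy, hzw, abs_mul]
  calc |derivWithin f (Icc lo hi) ξ| * |x - y| * |z - w|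
      ≤ Real.exp (H * δ ^ (α : ℝ)) * |derivWithin f (Icc lo hi) ζ| * |x - y| * |z - w| := by gcongr
    _ = _ := by ring

namespace ExpandingMap

section InverseBranches

variable {A : Type*} {B : A → A → Prop} {r : ℝ≥0∞} (G : ExpandingMap B r) {a b : A}

theorem lo_lt_hi (hab : B a b) : G.lo a b < G.hi a b := by
  by_contra! hle
  have h := (G.bijOn a b hab).image_eq ▸ (subsingleton_Icc_of_ge hle).image _
  exact zero_ne_one (h unitInterval.zero_mem unitInterval.one_mem)

theorem mapsTo_branch (hab : B a b) : MapsTo (G.branch a b) (Icc 0 1) (G.I₂ a b) :=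
  fun _ hx => Function.invFunOn_mem ((G.bijOn a b hab).surjOn hx)

theorem mapsTo_branch_Icc (hab : B a b) : MapsTo (G.branch a b) (Icc 0 1) (Icc 0 1) :=
  fun _ hx => G.subset_unit a b hab (G.mapsTo_branch hab hx)

theorem leftInvOn_branch (hab : B a b) :
    LeftInvOn (fun t => (G.g ⟨a, t⟩).2) (G.branch a b) (Icc 0 1) :=
  fun _ hx => Function.invFunOn_eq (f := fun t => (G.g ⟨a, t⟩).2) ((G.bijOn a b hab).surjOn hx)

theorem g_branch (hab : B a b) {x : ℝ} (hx : x ∈ Icc (0 : ℝ) 1) :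
    G.g ⟨a, G.branch a b x⟩ = ⟨b, x⟩ :=
  Sigma.ext (G.maps_fst a b hab _ (G.mapsTo_branch hab hx))
    (heq_of_eq (G.leftInvOn_branch hab hx))

theorem exists_lipschitzOnWith_branch (hr : 1 < r) (hab : B a b) :
    ∃ θ : Iio (1 : ℝ≥0), LipschitzOnWith θ (G.branch a b) (Icc 0 1) := by
  obtain ⟨m, hm, h⟩ := exists_lt_forall_mul_abs_sub_le (G.lo_lt_hi hab)
    ((G.smooth a b hab).contDiffOn_one hr) (G.expanding a b hab)
  lift m to ℝ≥0 using zero_le_one.trans hm.le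
  have hm1 : 1 < m := by exact_mod_cast hm
  refine ⟨⟨m⁻¹, inv_lt_one_of_one_lt₀ hm1⟩, LipschitzOnWith.of_dist_le_mul fun x hx y hy => ?_⟩
  have hxy := h _ (G.mapsTo_branch hab hx) _ (G.mapsTo_branch hab hy)
  rw [G.g_branch hab hx, G.g_branch hab hy] at hxy
  rwa [NNReal.coe_inv, inv_mul_eq_div, le_div_iff₀' (zero_lt_one.trans hm), Real.dist_eq,
    Real.dist_eq]

theorem distortionOnWith_branch (hr : 1 < r) (hab : B a b) {H α : ℝ≥0}
    (hH : HolderOnWith H α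
      (derivWithin (fun t => (G.g ⟨a, t⟩).2) (Icc (G.lo a b) (G.hi a b)))
      (Icc (G.lo a b) (G.hi a b)))
    {s : Set ℝ} (hs : s ⊆ Icc 0 1) (hconn : (G.branch a b '' s).OrdConnected) {δ : ℝ}
    (hδ : ∀ x ∈ G.branch a b '' s, ∀ y ∈ G.branch a b '' s, dist x y ≤ δ) :
    DistortionOnWith (Real.exp (H * δ ^ (α : ℝ))) (G.branch a b) s := by
  have hsub : G.branch a b '' s ⊆ Icc (G.lo a b) (G.hi a b) :=
    ((G.mapsTo_branch hab).mono_left hs).image_subset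
  exact (distortionOnWith_exp_of_holderOnWith
    (((G.smooth a b hab).contDiffOn_one hr).differentiableOn one_ne_zero) hsub
    (fun t ht => (G.expanding a b hab t (hsub ht)).le) (hH.mono hsub) hδ).of_leftInvOn
    (mapsTo_image _ _) ((G.leftInvOn_branch hab).mono hs)

theorem exists_le_dist_branch {b' : A} (hab : B a b) (hab' : B a b') (hne : b ≠ b') :
    ∃ δ : Ioi (0 : ℝ), ∀ x ∈ Icc (0 : ℝ) 1, ∀ y ∈ Icc (0 : ℝ) 1,
      δ ≤ dist (G.branch a b x) (G.branch a b' y) := by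
  obtain ⟨δ, hδ, h⟩ := Metric.exists_pos_forall_lt_edist isCompact_Icc isClosed_Icc
    (G.disjoint a b b' hab hab' hne)
  refine ⟨⟨δ, hδ⟩, fun x hx y hy => ?_⟩
  have := h _ (G.mapsTo_branch hab hx) _ (G.mapsTo_branch hab' hy)
  rw [edist_nndist, ENNReal.coe_lt_coe] at this
  exact_mod_cast this.le

end InverseBranches

section WordMaps

variable {A : Type*} {B : A → A → Prop} {r : ℝ≥0∞} (G : ExpandingMap B r) {c : List A}

theorem wordMap_cons_cons (a b : A) (w : List A) :
    G.wordMap (a :: b :: w) = G.branch a b ∘ G.wordMap (b :: w) := rfl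

theorem wordMap_append_cons (u : List A) (e : A) (v : List A) :
    G.wordMap (u ++ e :: v) = G.wordMap (u ++ [e]) ∘ G.wordMap (e :: v) := by
  induction u with
  | nil => rfl
  | cons a u ih =>
    cases u with
    | nil => rfl
    | cons b u =>
      simp only [List.cons_append, wordMap_cons_cons] at ih ⊢
      rw [ih, Function.comp_assoc]

theorem mapsTo_wordMap (hc : c.IsChain B) : MapsTo (G.wordMap c) (Icc 0 1) (Icc 0 1) := by
  induction c using List.twoStepInduction with
  | nil | singleton => exact mapsTo_id _
  | cons_cons a b w _ ih =>
    rw [List.isChain_cons_cons] at hc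
    exact (G.mapsTo_branch_Icc hc.1).comp (ih b hc.2)

theorem injOn_wordMap (hc : c.IsChain B) : InjOn (G.wordMap c) (Icc 0 1) := by
  induction c using List.twoStepInduction with
  | nil | singleton => exact injOn_id _
  | cons_cons a b w _ ih =>
    rw [List.isChain_cons_cons] at hc
    exact (G.leftInvOn_branch hc.1).injOn.comp (ih b hc.2) (G.mapsTo_wordMap hc.2)

theorem lipschitzOnWith_wordMap {θ : ℝ≥0}
    (hθ : ∀ a b, B a b → LipschitzOnWith θ (G.branch a b) (Icc 0 1)) (hc : c.IsChain B) :
    LipschitzOnWith (θ ^ (c.length - 1)) (G.wordMap c) (Icc 0 1) := by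
  induction c using List.twoStepInduction with
  | nil | singleton => exact LipschitzWith.id.lipschitzOnWith
  | cons_cons a b w _ ih =>
    rw [List.isChain_cons_cons] at hc
    have h := (hθ a b hc.1).comp (ih b hc.2) (G.mapsTo_wordMap hc.2)
    rwa [← pow_succ'] at h

theorem distortionOnWith_wordMap (hr : 1 < r) {θ H α : ℝ≥0}
    (hθ : ∀ a b, B a b → LipschitzOnWith θ (G.branch a b) (Icc 0 1))
    (hH : ∀ a b, B a b → HolderOnWith H α
      (derivWithin (fun t => (G.g ⟨a, t⟩).2) (Icc (G.lo a b) (G.hi a b)))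
      (Icc (G.lo a b) (G.hi a b)))
    (hc : c.IsChain B) :
    DistortionOnWith
      (Real.exp (H * ∑ j ∈ Finset.range (c.length - 1), ((θ : ℝ) ^ (α : ℝ)) ^ (j + 1)))
      (G.wordMap c) (Icc 0 1) := by
  induction c using List.twoStepInduction with
  | nil | singleton =>
    simpa only [wordMap, List.length_nil, List.length_singleton, Nat.sub_self, Nat.zero_sub,
      Finset.range_zero, Finset.sum_empty, mul_zero, Real.exp_zero] using distortionOnWith_id _
  | cons_cons a b w _ ih =>
    have hlip := G.lipschitzOnWith_wordMap hθ hc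
    have himage : G.branch a b '' (G.wordMap (b :: w) '' Icc 0 1) =
        G.wordMap (a :: b :: w) '' Icc 0 1 := by
      rw [wordMap_cons_cons, image_comp]
    rw [List.isChain_cons_cons] at hc
    have hbranch := G.distortionOnWith_branch hr hc.1 (hH a b hc.1) (δ := (θ : ℝ) ^ (w.length + 1))
      (G.mapsTo_wordMap hc.2).image_subset
      (himage ▸ (isPreconnected_Icc.image _ hlip.continuousOn).ordConnected) (by
        rw [himage]
        rintro _ ⟨x, hx, rfl⟩ _ ⟨y, hy, rfl⟩
        exact (hlip.dist_le_mul x hx y hy).trans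
          (mul_le_of_le_one_right (by positivity) (Real.dist_le_of_mem_Icc_01 hx hy)))
    have h := hbranch.comp (ih b hc.2) (mapsTo_image _ _) (Real.exp_pos _).le
    rw [← Real.exp_add, ← mul_add, ← Real.rpow_pow_comm θ.coe_nonneg, add_comm] at h
    simpa only [wordMap_cons_cons, List.length_cons, Nat.add_sub_cancel, Finset.sum_range_succ]
      using h

/-- The length `|I(c)|` up to bounded distortion: the distance between the images of the end points
of `[0,1]` by `f_c`. -/
noncomputable def len (c : List A) : ℝ := dist (G.wordMap c 0) (G.wordMap c 1)

theorem len_nonneg : 0 ≤ G.len c := dist_nonneg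

theorem len_pos (hc : c.IsChain B) : 0 < G.len c :=
  dist_pos.2 fun h =>
    zero_ne_one (G.injOn_wordMap hc unitInterval.zero_mem unitInterval.one_mem h)

theorem len_le_one (hc : c.IsChain B) : G.len c ≤ 1 :=
  Real.dist_le_of_mem_Icc_01 (G.mapsTo_wordMap hc unitInterval.zero_mem)
    (G.mapsTo_wordMap hc unitInterval.one_mem)

end WordMaps

/-- Estimates uniform over the words of `G`: inverse branches contract by `θ`, word maps have
distortion at most `D`, and distinct intervals `I(a, b)`, `I(a, b')` are at distance at least
`δ`. -/
structure UniformBounds {A : Type*} {B : A → A → Prop} {r : ℝ≥0∞} (G : ExpandingMap B r)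
    (θ : ℝ≥0) (D δ : ℝ) : Prop where
  θ_lt_one : θ < 1
  δ_pos : 0 < δ
  lipschitzOnWith : ∀ c : List A, c.IsChain B →
    LipschitzOnWith (θ ^ (c.length - 1)) (G.wordMap c) (Icc 0 1)
  distortionOnWith : ∀ c : List A, c.IsChain B → DistortionOnWith D (G.wordMap c) (Icc 0 1)
  le_dist_branch : ∀ a b b', B a b → B a b' → b ≠ b' → ∀ x ∈ Icc (0 : ℝ) 1, ∀ y ∈ Icc (0 : ℝ) 1,
    δ ≤ dist (G.branch a b x) (G.branch a b' y)

section Existence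

variable {A : Type*} [Finite A] {B : A → A → Prop} {r : ℝ≥0∞} (G : ExpandingMap B r)

theorem exists_forall_lipschitzOnWith_branch (hr : 1 < r) :
    ∃ θ : ℝ≥0, θ < 1 ∧ ∀ a b, B a b → LipschitzOnWith θ (G.branch a b) (Icc 0 1) := by
  choose θ hθ using fun p : {p : A × A // B p.1 p.2} => G.exists_lipschitzOnWith_branch hr p.2
  have : Nonempty (Iio (1 : ℝ≥0)) := ⟨⟨0, mem_Iio.2 zero_lt_one⟩⟩
  obtain ⟨θ₀, hθ₀⟩ := Finite.exists_le θ
  exact ⟨θ₀, θ₀.2, fun a b hab => (hθ ⟨(a, b), hab⟩).weaken (hθ₀ _)⟩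

theorem exists_forall_holderOnWith_derivWithin (hr : 1 < r) :
    ∃ H α : ℝ≥0, 0 < α ∧ ∀ a b, B a b → HolderOnWith H α
      (derivWithin (fun t => (G.g ⟨a, t⟩).2) (Icc (G.lo a b) (G.hi a b)))
      (Icc (G.lo a b) (G.hi a b)) := by
  obtain ⟨α, hα, h⟩ := exists_holderOnWith_derivWithin_of_isCr hr
  choose H hH using fun p : {p : A × A // B p.1 p.2} =>
    h _ _ _ (G.lo_lt_hi p.2) (G.smooth _ _ p.2)
  obtain ⟨H₀, hH₀⟩ := Finite.exists_le H
  refine ⟨H₀, α, hα, fun a b hab x hx y hy => (hH ⟨(a, b), hab⟩ x hx y hy).trans ?_⟩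
  gcongr
  exact hH₀ _

theorem exists_forall_le_dist_branch :
    ∃ δ > 0, ∀ a b b', B a b → B a b' → b ≠ b' → ∀ x ∈ Icc (0 : ℝ) 1, ∀ y ∈ Icc (0 : ℝ) 1,
      δ ≤ dist (G.branch a b x) (G.branch a b' y) := by
  choose δ hδ using fun p : {p : A × A × A // B p.1 p.2.1 ∧ B p.1 p.2.2 ∧ p.2.1 ≠ p.2.2} =>
    G.exists_le_dist_branch p.2.1 p.2.2.1 p.2.2.2
  obtain ⟨δ₀, hδ₀⟩ := Finite.exists_ge δ
  exact ⟨δ₀, δ₀.2, fun a b b' hab hab' hne x hx y hy =>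
    le_trans (hδ₀ _) (hδ ⟨(a, b, b'), hab, hab', hne⟩ x hx y hy)⟩

theorem exists_uniformBounds (hr : 1 < r) : ∃ θ D δ, G.UniformBounds θ D δ := by
  obtain ⟨θ, hθ, hlip⟩ := G.exists_forall_lipschitzOnWith_branch hr
  obtain ⟨H, α, hα, hH⟩ := G.exists_forall_holderOnWith_derivWithin hr
  obtain ⟨δ, hδ, hsep⟩ := G.exists_forall_le_dist_branch
  have hsum : Summable fun j : ℕ => ((θ : ℝ) ^ (α : ℝ)) ^ (j + 1) :=
    (summable_nat_add_iff 1).2 <| summable_geometric_of_lt_one (by positivity)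
      (Real.rpow_lt_one θ.coe_nonneg hθ hα)
  set T := ∑' j : ℕ, ((θ : ℝ) ^ (α : ℝ)) ^ (j + 1)
  refine ⟨θ, Real.exp (H * T), δ, hθ, hδ, fun c hc => G.lipschitzOnWith_wordMap hlip hc, fun c hc =>
    (G.distortionOnWith_wordMap hr hlip hH hc).mono_const ?_, hsep⟩
  gcongr
  exact hsum.sum_le_tsum _ fun _ _ => by positivity

end Existence

namespace UniformBounds

variable {A : Type*} {B : A → A → Prop} {r : ℝ≥0∞} {G : ExpandingMap B r} {θ : ℝ≥0} {D δ : ℝ}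
  (hG : G.UniformBounds θ D δ) {c : List A}

include hG

theorem one_le : 1 ≤ D := by
  simpa [wordMap] using hG.distortionOnWith [] .nil 0 unitInterval.zero_mem 1 unitInterval.one_mem
    0 unitInterval.zero_mem 1 unitInterval.one_mem

theorem pos : 0 < D := zero_lt_one.trans_le hG.one_le

theorem dist_wordMap_le (hc : c.IsChain B) {x y : ℝ} (hx : x ∈ Icc (0 : ℝ) 1)
    (hy : y ∈ Icc (0 : ℝ) 1) :
    dist (G.wordMap c x) (G.wordMap c y) ≤ D * (G.len c * dist x y) := by
  simpa [len] using
    hG.distortionOnWith c hc x hx y hy 0 unitInterval.zero_mem 1 unitInterval.one_mem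

theorem dist_wordMap_le_len (hc : c.IsChain B) {x y : ℝ} (hx : x ∈ Icc (0 : ℝ) 1)
    (hy : y ∈ Icc (0 : ℝ) 1) : dist (G.wordMap c x) (G.wordMap c y) ≤ D * G.len c := by
  have := hG.pos
  refine (hG.dist_wordMap_le hc hx hy).trans ?_
  gcongr
  exact mul_le_of_le_one_right dist_nonneg (Real.dist_le_of_mem_Icc_01 hx hy)

theorem len_mul_dist_le (hc : c.IsChain B) {x y : ℝ} (hx : x ∈ Icc (0 : ℝ) 1)
    (hy : y ∈ Icc (0 : ℝ) 1) :
    G.len c * dist x y ≤ D * dist (G.wordMap c x) (G.wordMap c y) := by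
  simpa [len] using
    hG.distortionOnWith c hc 0 unitInterval.zero_mem 1 unitInterval.one_mem x hx y hy

theorem len_append_cons_le {u v : List A} {e : A} (hc : (u ++ e :: v).IsChain B) :
    G.len (u ++ e :: v) ≤ D * (G.len (u ++ [e]) * G.len (e :: v)) := by
  obtain ⟨hu, hv⟩ := List.isChain_split.1 hc
  rw [len, wordMap_append_cons]
  exact hG.dist_wordMap_le hu (G.mapsTo_wordMap hv unitInterval.zero_mem)
    (G.mapsTo_wordMap hv unitInterval.one_mem)

theorem len_mul_len_le {u v : List A} {e : A} (hc : (u ++ e :: v).IsChain B) :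
    G.len (u ++ [e]) * G.len (e :: v) ≤ D * G.len (u ++ e :: v) := by
  obtain ⟨hu, hv⟩ := List.isChain_split.1 hc
  rw [len.eq_def _ (u ++ e :: v), wordMap_append_cons]
  exact hG.len_mul_dist_le hu (G.mapsTo_wordMap hv unitInterval.zero_mem)
    (G.mapsTo_wordMap hv unitInterval.one_mem)

theorem len_le_pow (hc : c.IsChain B) : G.len c ≤ (θ : ℝ) ^ (c.length - 1) := by
  simpa [len] using
    (hG.lipschitzOnWith c hc).dist_le_mul 0 unitInterval.zero_mem 1 unitInterval.one_mem

theorem len_le_diam (hc : c.IsChain B) : G.len c ≤ Metric.diam (G.wordInterval c) :=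
  Metric.dist_le_diam_of_mem
    (isCompact_Icc.image_of_continuousOn (hG.lipschitzOnWith c hc).continuousOn).isBounded
    (mem_image_of_mem _ unitInterval.zero_mem) (mem_image_of_mem _ unitInterval.one_mem)

theorem diam_le_mul_len (hc : c.IsChain B) : Metric.diam (G.wordInterval c) ≤ D * G.len c := by
  refine Metric.diam_le_of_forall_dist_le (mul_nonneg hG.pos.le G.len_nonneg) ?_
  rintro _ ⟨x, hx, rfl⟩ _ ⟨y, hy, rfl⟩
  exact hG.dist_wordMap_le_len hc hx hy

theorem finite_setOf_le_len [Finite A] {η : ℝ} (hη : 0 < η) :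
    {c : List A | c.IsChain B ∧ η ≤ G.len c}.Finite := by
  obtain ⟨n, hn⟩ := exists_pow_lt_of_lt_one hη (show (θ : ℝ) < 1 from hG.θ_lt_one)
  refine (List.finite_length_le A n).subset fun c hc => ?_
  by_contra! hlt
  rw [mem_ofPred_eq, not_le] at hlt
  refine (hn.trans_le (hc.2.trans (hG.len_le_pow hc.1))).not_ge ?_
  exact pow_le_pow_of_le_one θ.coe_nonneg hG.θ_lt_one.le (Nat.le_sub_one_of_lt hlt)

end UniformBounds

end ExpandingMap

theorem coe_le_dimH_range_of_dist_le_mul_rpow {α X : Type*} [MetricSpace X] {x : α → X}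
    {φ : α → ℝ} (hφ : Icc 0 1 ⊆ range φ) {C s : ℝ≥0} (hs : 0 < s)
    (h : ∀ p q, dist (φ p) (φ q) ≤ C * dist (x p) (x q) ^ (s : ℝ)) : s ≤ dimH (range x) := by
  have hfactor : φ.FactorsThrough x := fun p q hpq => by
    have := h p q
    rw [hpq, dist_self, Real.zero_rpow (by positivity), mul_zero] at this
    exact dist_le_zero.1 this
  let Φ := Function.extend x φ 0
  have hΦ p : Φ (x p) = φ p := hfactor.extend_apply _ p
  have hholder : HolderOnWith C s Φ (range x) := by
    rintro _ ⟨p, rfl⟩ _ ⟨q, rfl⟩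
    rw [hΦ, hΦ, edist_nndist, edist_nndist,
      ← ENNReal.coe_rpow_of_nonneg _ s.coe_nonneg]
    exact_mod_cast h p q
  have hsub : Icc 0 1 ⊆ Φ '' range x := fun t ht => by
    obtain ⟨p, rfl⟩ := hφ ht
    exact ⟨x p, mem_range_self p, hΦ p⟩
  have hone : 1 ≤ dimH (range x) / s := by
    have hunit : dimH (Icc (0 : ℝ) 1) = 1 := by
      rw [Real.dimH_of_nonempty_interior (by simp), Module.finrank_self, Nat.cast_one]
    exact hunit ▸ (dimH_mono hsub).trans (hholder.dimH_image_le hs)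
  rwa [ENNReal.le_div_iff_mul_le (Or.inl (by positivity)) (Or.inl ENNReal.coe_ne_top),
    one_mul] at hone

/-- The composition `f_{ω 0} ∘ ⋯ ∘ f_{ω (n - 1)}`. -/
def ifsComp {ι X : Type*} (f : ι → X → X) : (ℕ → ι) → ℕ → X → X
  | _, 0 => id
  | ω, n + 1 => f (ω 0) ∘ ifsComp f (fun i => ω (i + 1)) n

/-- The limit set of the iterated function system `f`: the points with an itinerary. -/
def limitSet {ι X : Type*} (f : ι → X → X) : Set X :=
  {x | ∃ ω, ∀ n, x ∈ range (ifsComp f ω n)}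

section IteratedFunctionSystems

variable {ι X : Type*} {f : ι → X → X}

theorem range_ifsComp_succ (ω : ℕ → ι) (n : ℕ) :
    range (ifsComp f ω (n + 1)) = f (ω 0) '' range (ifsComp f (fun i => ω (i + 1)) n) :=
  range_comp _ _

theorem range_ifsComp_succ_subset (ω : ℕ → ι) (n : ℕ) :
    range (ifsComp f ω (n + 1)) ⊆ range (ifsComp f ω n) := by
  induction n generalizing ω with
  | zero => exact fun x _ => ⟨x, rfl⟩
  | succ n ih =>
    rw [range_ifsComp_succ, range_ifsComp_succ ω n]
    exact image_mono (ih _)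

theorem limitSet_subset_iUnion_image (hf : ∀ i, Function.Injective (f i)) :
    limitSet f ⊆ ⋃ i, f i '' limitSet f := by
  rintro x ⟨ω, hω⟩
  have hω' n : x ∈ f (ω 0) '' range (ifsComp f (fun i => ω (i + 1)) n) :=
    range_ifsComp_succ ω n ▸ hω (n + 1)
  obtain ⟨u, -, rfl⟩ := hω' 0
  exact mem_iUnion.2
    ⟨ω 0, u, ⟨fun i => ω (i + 1), fun n => (hf (ω 0)).mem_set_image.1 (hω' n)⟩, rfl⟩

theorem exists_forall_mem_range_ifsComp [TopologicalSpace X] [T2Space X] [CompactSpace X]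
    [Nonempty X] (hf : ∀ i, Continuous (f i)) (ω : ℕ → ι) :
    ∃ x, ∀ n, x ∈ range (ifsComp f ω n) := by
  have hcont : ∀ n ω, Continuous (ifsComp f ω n) := fun n => by
    induction n with
    | zero => exact fun _ => continuous_id
    | succ n ih => exact fun ω => (hf _).comp (ih _)
  have hcompact n : IsCompact (range (ifsComp f ω n)) := isCompact_range (hcont n ω)
  obtain ⟨x, hx⟩ := IsCompact.nonempty_iInter_of_sequence_nonempty_isCompact_isClosed
    (fun n => range (ifsComp f ω n)) (range_ifsComp_succ_subset ω) (fun _ => range_nonempty _)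
    (hcompact 0) fun n => (hcompact n).isClosed
  exact ⟨x, mem_iInter.1 hx⟩

variable [MetricSpace X]

theorem exists_forall_le_dist_of_disjoint_range [Finite ι] [CompactSpace X]
    (hf : ∀ i, Continuous (f i))
    (hdisj : Pairwise fun i j => Disjoint (range (f i)) (range (f j))) :
    ∃ δ > 0, ∀ i j, i ≠ j → ∀ x y, δ ≤ dist (f i x) (f j y) := by
  have hpair (p : {p : ι × ι // p.1 ≠ p.2}) :
      ∃ δ : Ioi (0 : ℝ), ∀ x y, δ ≤ dist (f p.1.1 x) (f p.1.2 y) := by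
    obtain ⟨δ, hδ, h⟩ := Metric.exists_pos_forall_lt_edist (isCompact_range (hf p.1.1))
      (isCompact_range (hf p.1.2)).isClosed (hdisj p.2)
    refine ⟨⟨δ, hδ⟩, fun x y => ?_⟩
    have := h _ (mem_range_self x) _ (mem_range_self y)
    rw [edist_nndist, ENNReal.coe_lt_coe] at this
    exact_mod_cast this.le
  choose δ hδ using hpair
  obtain ⟨δ₀, hδ₀⟩ := Finite.exists_ge δ
  exact ⟨δ₀, δ₀.2, fun i j hij x y => le_trans (hδ₀ _) (hδ ⟨(i, j), hij⟩ x y)⟩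

theorem le_pow_mul_dist_of_mem_range_ifsComp {K : ℝ≥0} (hK : ∀ i, AntilipschitzWith K (f i))
    {δ : ℝ} (hδ : ∀ i j, i ≠ j → ∀ x y, δ ≤ dist (f i x) (f j y)) {n : ℕ} {ω ω' : ℕ → ι}
    (heq : ∀ i < n, ω i = ω' i) (hne : ω n ≠ ω' n) {x y : X}
    (hx : x ∈ range (ifsComp f ω (n + 1))) (hy : y ∈ range (ifsComp f ω' (n + 1))) :
    δ ≤ K ^ n * dist x y := by
  rw [range_ifsComp_succ] at hx hy
  obtain ⟨u, hu, rfl⟩ := hx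
  obtain ⟨v, hv, rfl⟩ := hy
  induction n generalizing ω ω' u v with
  | zero => simpa only [pow_zero, one_mul] using hδ _ _ hne u v
  | succ n ih =>
    rw [range_ifsComp_succ] at hu hv
    obtain ⟨u, hu, rfl⟩ := hu
    obtain ⟨v, hv, rfl⟩ := hv
    have := ih (fun i hi => heq (i + 1) (by omega)) hne u hu v hv
    refine this.trans ?_
    rw [← heq 0 n.succ_pos, pow_succ, mul_assoc]
    gcongr
    exact (hK _).le_mul_dist _ _

theorem inv_pow_le_rpow_of_le_pow_mul {K s m δ t : ℝ} (hK : 0 < K) (hs : 0 ≤ s) (hKs : K ^ s = m)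
    (hδ : 0 < δ) {n : ℕ} (h : δ ≤ K ^ n * t) : (m ^ n)⁻¹ ≤ δ⁻¹ ^ s * t ^ s := by
  have ht : 0 < t := pos_of_mul_pos_right (hδ.trans_le h) (by positivity)
  rw [← hKs, Real.rpow_pow_comm hK.le, ← Real.inv_rpow (by positivity),
    ← Real.mul_rpow (by positivity) ht.le]
  gcongr
  rwa [inv_le_iff_one_le_mul₀ (by positivity), inv_mul_eq_div, div_mul_eq_mul_div,
    one_le_div hδ, mul_comm]

theorem ofReal_logb_card_le_dimH_limitSet [Fintype ι] [CompactSpace X] [Nonempty X]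
    (hcont : ∀ i, Continuous (f i)) {K : ℝ≥0} (hK1 : 1 < K) (hK : ∀ i, AntilipschitzWith K (f i))
    (hdisj : Pairwise fun i j => Disjoint (range (f i)) (range (f j)))
    (hι : 1 < Fintype.card ι) :
    ENNReal.ofReal (Real.logb K (Fintype.card ι)) ≤ dimH (limitSet f) := by
  obtain ⟨δ, hδ, hsep⟩ := exists_forall_le_dist_of_disjoint_range hcont hdisj
  choose x hx using exists_forall_mem_range_ifsComp hcont
  have hK0 : (0 : ℝ) < K := zero_lt_one.trans hK1
  have hm : (1 : ℝ) < Fintype.card ι := by exact_mod_cast hι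
  have hs : 0 < Real.logb K (Fintype.card ι) := Real.logb_pos hK1 hm
  have hKs : (K : ℝ) ^ Real.logb K (Fintype.card ι) = Fintype.card ι :=
    Real.rpow_logb hK0 (by exact_mod_cast hK1.ne') (zero_lt_one.trans hm)
  lift Real.logb K (Fintype.card ι) to ℝ≥0 using hs.le with s
  have : NeZero (Fintype.card ι) := ⟨by positivity⟩
  let φ (ω : ℕ → ι) : ℝ := Real.ofDigits (Fintype.equivFin ι ∘ ω)
  have hφ : Icc 0 1 ⊆ range φ := fun t ht => by
    obtain ⟨ω, -, rfl⟩ := Real.ofDigits_SurjOn hι ht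
    exact ⟨(Fintype.equivFin ι).symm ∘ ω, by
      simp only [φ, ← Function.comp_assoc, Equiv.self_comp_symm, Function.id_comp]⟩
  have hφx (ω ω' : ℕ → ι) : dist (φ ω) (φ ω') ≤ δ⁻¹ ^ (s : ℝ) * dist (x ω) (x ω') ^ (s : ℝ) := by
    rcases eq_or_ne ω ω' with rfl | hne
    · rw [dist_self]
      positivity
    have heq i (hi : i < PiNat.firstDiff ω ω') : ω i = ω' i := PiNat.apply_eq_of_lt_firstDiff hi
    refine (Real.abs_ofDigits_sub_ofDigits_le fun i hi => congrArg _ (heq i hi)).trans ?_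
    exact inv_pow_le_rpow_of_le_pow_mul hK0 hs.le hKs hδ <|
      le_pow_mul_dist_of_mem_range_ifsComp hK hsep heq (PiNat.apply_firstDiff_ne hne)
        (hx ω _) (hx ω' _)
  rw [ENNReal.ofReal_coe_nnreal]
  lift δ to ℝ≥0 using hδ.le
  exact (coe_le_dimH_range_of_dist_le_mul_rpow (C := δ⁻¹ ^ (s : ℝ)) hφ hs
    (by exact_mod_cast hφx)).trans (dimH_mono (range_subset_iff.2 fun ω => ⟨ω, hx ω⟩))

end IteratedFunctionSystems

section Words

variable {A : Type*} {B : A → A → Prop}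

/-- The words with transition set `B` that begin by `a`. -/
def wordsFrom (B : A → A → Prop) (a : A) : Set (List A) :=
  {c | c.IsChain B ∧ c.head? = some a}

/-- The words with transition set `B` that begin and end by `b`. -/
def loops (B : A → A → Prop) (b : A) : Set (List A) :=
  {c ∈ wordsFrom B b | c.getLast? = some b}

/-- The transition set is irreducible: any letter can be joined to any other by a word. -/
def IsIrreducibleTransition (B : A → A → Prop) : Prop :=
  ∀ a b, Relation.ReflTransGen B a b

theorem exists_cons_mem_wordsFrom {a : A} {c : List A} (hc : c ∈ wordsFrom B a) :
    ∃ v, c = a :: v := by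
  obtain ⟨v, hv⟩ := List.head?_eq_some_iff.1 hc.2
  exact ⟨v, hv⟩

theorem exists_maximal_common_prefix {a : A} {S : Set (List A)} (hhead : ∀ c ∈ S, c.head? = some a)
    (hanti : IsAntichain (· <+: ·) S) (hS : S.Nontrivial) :
    ∃ u e, (∀ c ∈ S, u ++ [e] <+: c) ∧
      ∃ b b' v v', b ≠ b' ∧ u ++ e :: b :: v ∈ S ∧ u ++ e :: b' :: v' ∈ S := by
  obtain ⟨c, hc⟩ := hS.nonempty
  have hfin : {w | w ≠ [] ∧ ∀ c ∈ S, w <+: c}.Finite :=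
    c.inits.finite_toSet.subset fun w hw => (List.mem_inits ..).2 (hw.2 c hc)
  have hne : [a] ∈ {w | w ≠ [] ∧ ∀ c ∈ S, w <+: c} := by
    refine ⟨List.cons_ne_nil _ _, fun c hc => ?_⟩
    obtain ⟨v, rfl⟩ := List.head?_eq_some_iff.1 (hhead c hc)
    exact List.prefix_append [a] v
  obtain ⟨w, ⟨hw, hpre⟩, hmax⟩ := hfin.exists_maximalFor List.length _ ⟨_, hne⟩
  have hlong : ∀ c ∈ S, ∃ b v, c = w ++ b :: v := fun c hc => by
    obtain ⟨t, rfl⟩ := hpre c hc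
    rcases t with _ | ⟨b, v⟩
    · obtain ⟨c', hc', hne'⟩ := hS.exists_ne (w ++ [])
      rw [List.append_nil] at hc hne'
      exact absurd (hpre c' hc') (hanti hc hc' hne'.symm)
    · exact ⟨b, v, rfl⟩
  obtain ⟨b, v, rfl⟩ := hlong c hc
  obtain ⟨c', hc', hnot⟩ : ∃ c' ∈ S, ¬ w ++ [b] <+: c' := by
    by_contra! hall
    have := hmax ⟨List.append_ne_nil_of_left_ne_nil hw _, hall⟩ (by simp)
    simp at this
  obtain ⟨b', v', rfl⟩ := hlong c' hc'
  obtain ⟨u, e, rfl⟩ := List.eq_nil_or_concat' w |>.resolve_left hw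
  refine ⟨u, e, hpre, b, b', v, v', ?_, by simpa using hc, by simpa using hc'⟩
  rintro rfl
  exact hnot ⟨v', by simp⟩

theorem isAntichain_image_of_prefix {S : Set (List A)} (hanti : IsAntichain (· <+: ·) S)
    {F : List A → List A} (hF : ∀ c ∈ S, c <+: F c) : IsAntichain (· <+: ·) (F '' S) := by
  rintro _ ⟨c, hc, rfl⟩ _ ⟨c', hc', rfl⟩ hne hpre
  have hcc' : c ≠ c' := fun h => hne (congrArg F h)
  exact (List.prefix_or_prefix_of_prefix ((hF c hc).trans hpre) (hF c' hc')).elim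
    (hanti hc hc' hcc') (hanti hc' hc hcc'.symm)

theorem injOn_of_isAntichain_of_prefix {S : Set (List A)} (hanti : IsAntichain (· <+: ·) S)
    {F : List A → List A} (hF : ∀ c ∈ S, c <+: F c) : InjOn F S := by
  intro c hc c' hc' heq
  by_contra hne
  exact (List.prefix_or_prefix_of_prefix (hF c hc) (heq ▸ hF c' hc')).elim
    (hanti hc hc' hne) (hanti hc' hc (Ne.symm hne))

theorem exists_finset_wordsFrom_of_common_prefix {u : List A} {e : A} {S : Finset (List A)}
    (hchain : ∀ c ∈ S, c.IsChain B) (hanti : IsAntichain (· <+: ·) (S : Set (List A)))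
    (hpre : ∀ c ∈ S, u ++ [e] <+: c) :
    ∃ S' : Finset (List A), ↑S' ⊆ wordsFrom B e ∧ IsAntichain (· <+: ·) (S' : Set (List A)) ∧
      S'.card = S.card ∧ ∀ w ∈ S', u ++ w ∈ S := by
  classical
  have hinj : Function.Injective (u ++ ·) := List.append_right_injective u
  have hmem : ∀ w ∈ S.preimage (u ++ ·) hinj.injOn, u ++ w ∈ S := fun w => Finset.mem_preimage.1
  refine ⟨S.preimage (u ++ ·) hinj.injOn, fun w hw => ?_, fun w hw w' hw' hne hww' => ?_, ?_, hmem⟩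
  · obtain ⟨v, rfl⟩ := (List.prefix_append_right_inj u).1 (hpre _ (hmem w hw))
    exact ⟨(List.isChain_split.1 (hchain _ (hmem _ hw))).2, rfl⟩
  · exact hanti (hmem w hw) (hmem w' hw') (hinj.ne hne) ((List.prefix_append_right_inj u).2 hww')
  · rw [Finset.card_preimage, Finset.filter_true_of_mem]
    intro c hc
    obtain ⟨v, rfl⟩ := hpre c hc
    exact ⟨[e] ++ v, (List.append_assoc ..).symm⟩

end Words

namespace ExpandingMap

section Loops

variable {A : Type*} {B : A → A → Prop} {r : ℝ≥0∞} (G : ExpandingMap B r)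

theorem subset_K_of_mapsTo {Λ : Set ((_ : A) × ℝ)} (hdom : Λ ⊆ G.domain) (hmap : MapsTo G.g Λ Λ) :
    Λ ⊆ G.K :=
  fun _ hp => mem_iInter.2 fun n => hdom (hmap.iterate n hp)

theorem image_mk_subset_K {b : A} {S : Set (List A)} (hS : ∀ c ∈ S, c ∈ loops B b ∧ c ≠ [b])
    {Λ : Set ℝ} (hΛ : Λ ⊆ Icc 0 1) (hcover : Λ ⊆ ⋃ c ∈ S, G.wordMap c '' Λ) :
    Sigma.mk b '' Λ ⊆ G.K := by
  -- the orbits, under `G.g`, of the points over `Λ`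
  let Orb : Set ((_ : A) × ℝ) := {p | ∃ e e' v, ∃ y ∈ Λ, (e :: e' :: v).IsChain B ∧
    (e :: e' :: v).getLast? = some b ∧ p = ⟨e, G.wordMap (e :: e' :: v) y⟩}
  have hbase : Sigma.mk b '' Λ ⊆ Orb := by
    rintro _ ⟨x, hx, rfl⟩
    obtain ⟨c, hc, y, hy, rfl⟩ := mem_iUnion₂.1 (hcover hx)
    obtain ⟨⟨hw, hlast⟩, hne⟩ := hS c hc
    obtain ⟨_ | ⟨e, v⟩, rfl⟩ := exists_cons_mem_wordsFrom hw
    · exact absurd rfl hne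
    · exact ⟨b, e, v, y, hy, hw.1, hlast, rfl⟩
  refine hbase.trans (G.subset_K_of_mapsTo ?_ ?_)
  · rintro _ ⟨e, e', v, y, hy, hch, -, rfl⟩
    rw [List.isChain_cons_cons] at hch
    exact ⟨e', hch.1, G.mapsTo_branch hch.1 (G.mapsTo_wordMap hch.2 (hΛ hy))⟩
  · rintro _ ⟨e, e', v, y, hy, hch, hlast, rfl⟩
    rw [List.isChain_cons_cons] at hch
    rw [List.getLast?_cons_cons] at hlast
    rw [wordMap_cons_cons, Function.comp_apply, G.g_branch hch.1 (G.mapsTo_wordMap hch.2 (hΛ hy))]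
    rcases v with _ | ⟨e'', v⟩
    · obtain rfl : e' = b := Option.some_injective _ hlast
      exact hbase (mem_image_of_mem _ hy)
    · exact ⟨e', e'', v, y, hy, hch.2, hlast, rfl⟩

theorem prefix_or_prefix_of_wordMap_eq {a : A} {v w : List A} (hv : (a :: v).IsChain B)
    (hw : (a :: w).IsChain B) {x y : ℝ} (hx : x ∈ Icc (0 : ℝ) 1) (hy : y ∈ Icc (0 : ℝ) 1)
    (h : G.wordMap (a :: v) x = G.wordMap (a :: w) y) : a :: v <+: a :: w ∨ a :: w <+: a :: v := by
  induction v generalizing a w with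
  | nil => exact Or.inl (List.prefix_append [a] w)
  | cons b v ih =>
    rcases w with _ | ⟨b', w⟩
    · exact Or.inr (List.prefix_append [a] _)
    rw [List.isChain_cons_cons] at hv hw
    have hg := congrArg (fun t => G.g ⟨a, t⟩) h
    simp only [wordMap_cons_cons, Function.comp_apply,
      G.g_branch hv.1 (G.mapsTo_wordMap hv.2 hx), G.g_branch hw.1 (G.mapsTo_wordMap hw.2 hy),
      Sigma.mk.injEq, heq_eq_eq] at hg
    obtain ⟨rfl, hxy⟩ := hg
    simpa only [List.prefix_cons_inj] using ih hv.2 hw.2 hxy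

theorem disjoint_image_wordMap {a : A} {S : Set (List A)} (hS : S ⊆ wordsFrom B a)
    (hanti : IsAntichain (· <+: ·) S) {c c' : List A} (hc : c ∈ S) (hc' : c' ∈ S) (hne : c ≠ c') :
    Disjoint (G.wordMap c '' Icc 0 1) (G.wordMap c' '' Icc 0 1) := by
  refine Set.disjoint_left.2 ?_
  rintro _ ⟨x, hx, rfl⟩ ⟨y, hy, heq⟩
  obtain ⟨v, rfl⟩ := exists_cons_mem_wordsFrom (hS hc)
  obtain ⟨w, rfl⟩ := exists_cons_mem_wordsFrom (hS hc')
  exact (G.prefix_or_prefix_of_wordMap_eq (hS hc).1 (hS hc').1 hx hy heq.symm).elim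
    (hanti hc hc' hne) (hanti hc' hc hne.symm)

theorem dimH_le_HD_of_subset {b : A} {S : Set (List A)} (hS : ∀ c ∈ S, c ∈ loops B b ∧ c ≠ [b])
    {Λ : Set (Icc (0 : ℝ) 1)}
    (hcover : ((↑) '' Λ : Set ℝ) ⊆ ⋃ c ∈ S, G.wordMap c '' ((↑) '' Λ)) : dimH Λ ≤ G.HD := by
  let : MetricSpace ((_ : A) × ℝ) := Metric.Sigma.metricSpace
  calc dimH Λ = dimH ((↑) '' Λ : Set ℝ) := (isometry_subtype_coe.dimH_image Λ).symm
    _ = dimH (Sigma.mk (β := fun _ : A => ℝ) b '' ((↑) '' Λ)) :=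
      ((Metric.Sigma.isometry_mk (E := fun _ : A => ℝ) b).dimH_image _).symm
    _ ≤ G.HD := dimH_mono (G.image_mk_subset_K hS (Subtype.coe_image_subset _ _) hcover)

end Loops

end ExpandingMap

namespace ExpandingMap.UniformBounds

section Counting

variable {A : Type*} {B : A → A → Prop} {r : ℝ≥0∞} {G : ExpandingMap B r} {θ : ℝ≥0} {D δ : ℝ}

theorem antilipschitzWith_restrict_wordMap (hG : G.UniformBounds θ D δ) {c : List A}
    (hc : c.IsChain B) {η : ℝ} (hη : 0 < η) (hlen : η ≤ G.len c) {K : ℝ≥0} (hK : D / η ≤ K) :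
    AntilipschitzWith K ((G.mapsTo_wordMap hc).restrict) := by
  refine AntilipschitzWith.of_le_mul_dist fun x y => ?_
  calc dist x y = (η * dist (x : ℝ) y) / η := (mul_div_cancel_left₀ _ hη.ne').symm
    _ ≤ (G.len c * dist (x : ℝ) y) / η := by gcongr
    _ ≤ (D * dist (G.wordMap c x) (G.wordMap c y)) / η := by
      exact div_le_div_of_nonneg_right (hG.len_mul_dist_le hc x.2 y.2) hη.le
    _ = D / η * dist (G.wordMap c x) (G.wordMap c y) := by ring
    _ ≤ K * dist (G.wordMap c x) (G.wordMap c y) := by gcongr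

theorem card_le_of_subset_loops (hG : G.UniformBounds θ D δ) (hHD : G.HD ≠ ⊤) {b : A}
    {S : Finset (List A)} (hS : ↑S ⊆ loops B b) (hanti : IsAntichain (· <+: ·) (S : Set (List A)))
    {η : ℝ} (hη : 0 < η) (hlen : ∀ c ∈ S, η ≤ G.len c) :
    (S.card : ℝ) ≤ (2 * D / η) ^ G.HD.toReal := by
  have hD := hG.one_le
  rcases S.eq_empty_or_nonempty with rfl | ⟨c₀, hc₀⟩
  · rw [Finset.card_empty, Nat.cast_zero]
    positivity
  have hK1 : 1 < 2 * D / η := by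
    rw [one_lt_div hη]
    linarith [(hlen c₀ hc₀).trans (G.len_le_one (hS hc₀).1.1)]
  lift 2 * D / η to ℝ≥0 using zero_le_one.trans hK1.le with K hK
  rcases le_or_gt S.card 1 with hcard | hcard
  · exact (Nat.cast_le_one.2 hcard).trans (Real.one_le_rpow hK1.le ENNReal.toReal_nonneg)
  have hne : ∀ c ∈ S, c ≠ [b] := by
    rintro _ hb rfl
    obtain ⟨c, hc, hcb⟩ := S.exists_mem_ne hcard [b]
    obtain ⟨v, rfl⟩ := exists_cons_mem_wordsFrom (hS hc).1
    exact hanti hb hc hcb.symm (List.prefix_append [b] v)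
  let f (c : S) := (G.mapsTo_wordMap (hS c.2).1.1).restrict
  have hcont (c : S) : Continuous (f c) :=
    (hG.lipschitzOnWith c (hS c.2).1.1).continuousOn.mapsToRestrict _
  have hdisj : Pairwise fun c c' => Disjoint (range (f c)) (range (f c')) := fun c c' hcc' => by
    have := G.disjoint_image_wordMap (fun _ hc => (hS hc).1) hanti c.2 c'.2
      (Subtype.coe_injective.ne hcc')
    refine Set.disjoint_left.2 ?_
    rintro _ ⟨x, rfl⟩ ⟨y, hxy⟩
    exact Set.disjoint_left.1 this (mem_image_of_mem _ x.2) ⟨y, y.2, congrArg Subtype.val hxy⟩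
  have hantilip (c : S) : AntilipschitzWith K (f c) :=
    hG.antilipschitzWith_restrict_wordMap (hS c.2).1.1 hη (hlen c c.2) <| by
      rw [hK]
      gcongr
      linarith
  have hcover : ((↑) '' limitSet f : Set ℝ) ⊆ ⋃ c ∈ S, G.wordMap c '' ((↑) '' limitSet f) := by
    rintro _ ⟨x, hx, rfl⟩
    have hinj (c : S) : Function.Injective (f c) := (hantilip c).injective
    obtain ⟨c, y, hy, rfl⟩ := mem_iUnion.1 (limitSet_subset_iUnion_image hinj hx)
    exact mem_iUnion₂.2 ⟨c, c.2, mem_image_of_mem _ (mem_image_of_mem _ hy)⟩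
  have hdim := (ofReal_logb_card_le_dimH_limitSet hcont hK1 hantilip hdisj
    (by rwa [Fintype.card_coe])).trans
    (G.dimH_le_HD_of_subset (fun c hc => ⟨hS hc, hne c hc⟩) hcover)
  rw [ENNReal.ofReal_le_iff_le_toReal hHD, Fintype.card_coe] at hdim
  exact (Real.logb_le_iff_le_rpow hK1 (by positivity)).1 hdim

variable [Finite A] (hirr : IsIrreducibleTransition B)

include hirr

theorem exists_connecting_words (G : ExpandingMap B r) : ∃ μ > 0, ∀ e b : A, ∃ v : List A,
    (e :: v).IsChain B ∧ (e :: v).getLast? = some b ∧ μ ≤ G.len (e :: v) := by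
  have hpair (e b : A) : ∃ v : List A, (e :: v).IsChain B ∧ (e :: v).getLast? = some b := by
    obtain ⟨v, hv, hlast⟩ := List.exists_isChain_cons_of_relationReflTransGen (hirr e b)
    exact ⟨v, hv, by rw [List.getLast?_eq_some_getLast (List.cons_ne_nil e v), hlast]⟩
  choose v hv hlast using hpair
  have : Nonempty (Ioi (0 : ℝ)) := ⟨⟨1, mem_Ioi.2 one_pos⟩⟩
  obtain ⟨μ, hμ⟩ := Finite.exists_ge fun p : A × A =>
    (⟨G.len (p.1 :: v p.1 p.2), G.len_pos (hv p.1 p.2)⟩ : Ioi (0 : ℝ))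
  exact ⟨μ, μ.2, fun e b => ⟨v e b, hv e b, hlast e b, hμ (e, b)⟩⟩

theorem exists_loop_extension (hG : G.UniformBounds θ D δ) :
    ∃ μ > 0, ∀ b, ∀ c ∈ wordsFrom B b, ∃ c' ∈ loops B b, c <+: c' ∧ μ * G.len c ≤ G.len c' := by
  obtain ⟨μ, hμ, hconn⟩ := exists_connecting_words hirr G
  have hD := hG.pos
  refine ⟨μ / D, by positivity, fun b c hc => ?_⟩
  obtain ⟨u, e, rfl⟩ := List.eq_nil_or_concat' c |>.resolve_left <| by
    obtain ⟨v, rfl⟩ := exists_cons_mem_wordsFrom hc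
    exact List.cons_ne_nil _ _
  obtain ⟨v, hv, hlast, hle⟩ := hconn e b
  have hchain : (u ++ e :: v).IsChain B := List.isChain_split.2 ⟨hc.1, hv⟩
  refine ⟨u ++ e :: v, ⟨⟨hchain, ?_⟩, ?_⟩, ⟨v, by simp⟩, ?_⟩
  · simpa using hc.2
  · rw [List.getLast?_append_cons, hlast]
  · rw [div_mul_eq_mul_div, div_le_iff₀' hD, mul_comm]
    exact (mul_le_mul_of_nonneg_left hle G.len_nonneg).trans (hG.len_mul_len_le hchain)

theorem exists_forall_card_le_of_isAntichain (hG : G.UniformBounds θ D δ) (hHD : G.HD ≠ ⊤) :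
    ∃ C, 0 < C ∧ ∀ (b : A) (η : ℝ) (S : Finset (List A)), 0 < η → ↑S ⊆ wordsFrom B b →
      IsAntichain (· <+: ·) (S : Set (List A)) → (∀ c ∈ S, η ≤ G.len c) →
        (S.card : ℝ) ≤ (C / η) ^ G.HD.toReal := by
  classical
  obtain ⟨μ, hμ, hext⟩ := exists_loop_extension hirr hG
  have hD := hG.pos
  refine ⟨2 * D / μ, by positivity, fun b η S hη hS hanti hlen => ?_⟩
  choose! F hF hpre hle using hext b
  have hpreS : ∀ c ∈ (S : Set (List A)), c <+: F c := fun c hc => hpre c (hS hc)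
  have hcard := hG.card_le_of_subset_loops hHD (S := S.image F) (b := b) (η := μ * η)
    (by
      rw [Finset.coe_image]
      exact image_subset_iff.2 fun c hc => hF c (hS hc))
    (by
      rw [Finset.coe_image]
      exact isAntichain_image_of_prefix hanti hpreS)
    (by positivity)
    (Finset.forall_mem_image.2 fun c hc =>
      (mul_le_mul_of_nonneg_left (hlen c hc) hμ.le).trans (hle c (hS hc)))
  rwa [Finset.card_image_of_injOn (injOn_of_isAntichain_of_prefix hanti hpreS), ← div_div] at hcard

omit [Finite A] hirr in
theorem len_mul_le_of_append_mem (hG : G.UniformBounds θ D δ) {u v v' : List A} {e b b' : A}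
    (hc : (u ++ e :: b :: v).IsChain B) (hc' : (u ++ e :: b' :: v').IsChain B) (hne : b ≠ b')
    {x y : ℝ} (hx : x ∈ Icc (0 : ℝ) 1) (hy : y ∈ Icc (0 : ℝ) 1) :
    G.len (u ++ [e]) * δ ≤
      D * dist (G.wordMap (u ++ e :: b :: v) x) (G.wordMap (u ++ e :: b' :: v') y) := by
  obtain ⟨hu, hv⟩ := List.isChain_split.1 hc
  obtain ⟨-, hv'⟩ := List.isChain_split.1 hc'
  rw [G.wordMap_append_cons u e (b :: v), G.wordMap_append_cons u e (b' :: v')]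
  have hsep : δ ≤ dist (G.wordMap (e :: b :: v) x) (G.wordMap (e :: b' :: v') y) := by
    have h := List.isChain_cons_cons.1 hv
    have h' := List.isChain_cons_cons.1 hv'
    exact hG.le_dist_branch e b b' h.1 h'.1 hne _ (G.mapsTo_wordMap h.2 hx) _
      (G.mapsTo_wordMap h'.2 hy)
  exact (mul_le_mul_of_nonneg_left hsep G.len_nonneg).trans
    (hG.len_mul_dist_le hu (G.mapsTo_wordMap hv hx) (G.mapsTo_wordMap hv' hy))

theorem exists_forall_card_le_of_isAntichain_of_dist_le (hG : G.UniformBounds θ D δ)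
    (hHD : G.HD ≠ ⊤) :
    ∃ C, 0 < C ∧ ∀ (a : A) (η τ : ℝ) (S : Finset (List A)), 0 < η → η ≤ τ → ↑S ⊆ wordsFrom B a →
      IsAntichain (· <+: ·) (S : Set (List A)) → (∀ c ∈ S, η ≤ G.len c) →
        (∀ c ∈ S, ∀ c' ∈ S, dist (G.wordMap c 0) (G.wordMap c' 0) ≤ τ) →
          (S.card : ℝ) ≤ (C * (τ / η)) ^ G.HD.toReal := by
  obtain ⟨C, hC, hcount⟩ := exists_forall_card_le_of_isAntichain hirr hG hHD
  have hD := hG.pos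
  have hδ := hG.δ_pos
  refine ⟨max 1 (C * D ^ 2 / δ), by positivity, fun a η τ S hη hητ hS hanti hlen hdist => ?_⟩
  have hτ : 0 < τ := hη.trans_le hητ
  have hτη : 1 ≤ τ / η := (one_le_div hη).2 hητ
  rcases (S : Set (List A)).subsingleton_or_nontrivial with hsub | hnt
  · exact (Nat.cast_le_one.2 (Finset.card_le_one.2 hsub)).trans <| Real.one_le_rpow
      (one_le_mul_of_one_le_of_one_le (le_max_left _ _) hτη) ENNReal.toReal_nonneg
  obtain ⟨u, e, hpre, b, b', v, v', hne, hmem, hmem'⟩ :=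
    exists_maximal_common_prefix (fun c hc => (hS hc).2) hanti hnt
  have hue : G.len (u ++ [e]) * δ ≤ D * τ :=
    (hG.len_mul_le_of_append_mem (hS hmem).1 (hS hmem').1 hne unitInterval.zero_mem
      unitInterval.zero_mem).trans (mul_le_mul_of_nonneg_left (hdist _ hmem _ hmem') hD.le)
  obtain ⟨S', hS', hanti', hcard, hmem'⟩ :=
    exists_finset_wordsFrom_of_common_prefix (fun c hc => (hS hc).1) hanti hpre
  have hlen' : ∀ w ∈ S', η * δ / (D ^ 2 * τ) ≤ G.len w := fun w hw => by
    obtain ⟨v, rfl⟩ := exists_cons_mem_wordsFrom (hS' hw)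
    rw [div_le_iff₀' (by positivity)]
    calc η * δ ≤ D * (G.len (u ++ [e]) * G.len (e :: v)) * δ := by
          gcongr
          exact (hlen _ (hmem' _ hw)).trans (hG.len_append_cons_le (hS (hmem' _ hw)).1)
      _ = D * G.len (e :: v) * (G.len (u ++ [e]) * δ) := by ring
      _ ≤ D * G.len (e :: v) * (D * τ) :=
        mul_le_mul_of_nonneg_left hue (mul_nonneg hD.le G.len_nonneg)
      _ = D ^ 2 * τ * G.len (e :: v) := by ring
  rw [← hcard]
  refine (hcount e _ S' (by positivity) hS' hanti' hlen').trans
    (Real.rpow_le_rpow (by positivity) ?_ ENNReal.toReal_nonneg)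
  calc C / (η * δ / (D ^ 2 * τ)) = C * D ^ 2 / δ * (τ / η) := by field_simp
    _ ≤ _ := by
      gcongr
      exact le_max_right _ _

end Counting

section ComparableLengths

variable {A : Type*} {B : A → A → Prop} {r : ℝ≥0∞} {G : ExpandingMap B r} {θ : ℝ≥0} {D δ : ℝ}

theorem one_le_mul_pow_of_prefix (hG : G.UniformBounds θ D δ) {κ η : ℝ} (hη : 0 < η)
    {c c' : List A} (hne : c ≠ []) (hc' : c'.IsChain B) (hlen : G.len c ≤ κ * η)
    (hlen' : η ≤ G.len c') (hpre : c <+: c') :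
    1 ≤ D * κ * (θ : ℝ) ^ (c'.length - c.length) := by
  obtain ⟨t, rfl⟩ := hpre
  obtain ⟨u, e, rfl⟩ := List.eq_nil_or_concat' c |>.resolve_left hne
  have happ : u ++ [e] ++ t = u ++ e :: t := List.append_assoc ..
  have hlength : (u ++ [e] ++ t).length - (u ++ [e]).length = (e :: t).length - 1 := by
    simp only [List.length_append, List.length_cons, List.length_nil]
    omega
  have hD := hG.pos
  rw [hlength]
  rw [happ] at hc' hlen'
  refine le_of_mul_le_mul_right ?_ hη
  calc 1 * η ≤ D * (G.len (u ++ [e]) * G.len (e :: t)) :=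
        (one_mul η).trans_le (hlen'.trans (hG.len_append_cons_le hc'))
    _ ≤ D * (κ * η * (θ : ℝ) ^ ((e :: t).length - 1)) :=
      mul_le_mul_of_nonneg_left (mul_le_mul hlen (hG.len_le_pow (List.isChain_split.1 hc').2)
        G.len_nonneg (G.len_nonneg.trans hlen)) hD.le
    _ = D * κ * (θ : ℝ) ^ ((e :: t).length - 1) * η := by ring

theorem exists_isAntichain_filter_length_mod (hG : G.UniformBounds θ D δ) {κ : ℝ} (hκ : 0 < κ) :
    ∃ m, 0 < m ∧ ∀ {η : ℝ} {T : Set (List A)}, 0 < η → (∀ c ∈ T, c ≠ [] ∧ c.IsChain B) →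
      (∀ c ∈ T, η ≤ G.len c ∧ G.len c ≤ κ * η) →
        ∀ i, IsAntichain (· <+: ·) {c ∈ T | c.length % m = i} := by
  have hD := hG.pos
  obtain ⟨m, hm⟩ := exists_pow_lt_of_lt_one (show 0 < 1 / (D * κ) by positivity)
    (show (θ : ℝ) < 1 from hG.θ_lt_one)
  rw [lt_div_iff₀' (by positivity)] at hm
  refine ⟨m + 1, m.succ_pos, ?_⟩
  rintro η T hη hT hlen i c ⟨hc, rfl⟩ c' ⟨hc', hmod⟩ hne hpre
  have hlt : c.length < c'.length :=
    hpre.length_le.lt_of_ne fun h => hne (hpre.eq_of_length h)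
  have hle : m + 1 ≤ c'.length - c.length :=
    Nat.le_of_dvd (Nat.sub_pos_of_lt hlt) ((Nat.modEq_iff_dvd' hlt.le).1 hmod.symm)
  refine hm.not_ge ((hG.one_le_mul_pow_of_prefix hη (hT c hc).1 (hT c' hc').2 (hlen c hc).2
    (hlen c' hc').1 hpre).trans ?_)
  gcongr ?_ * ?_
  exact pow_le_pow_of_le_one θ.coe_nonneg hG.θ_lt_one.le (by omega)

theorem exists_forall_card_le_of_dist_le [Finite A] (hirr : IsIrreducibleTransition B)
    (hG : G.UniformBounds θ D δ) (hHD : G.HD ≠ ⊤) {κ : ℝ} (hκ : 0 < κ) :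
    ∃ C, 0 < C ∧ ∀ (a : A) (η τ : ℝ) (T : Finset (List A)), 0 < η → η ≤ τ → ↑T ⊆ wordsFrom B a →
      (∀ c ∈ T, η ≤ G.len c ∧ G.len c ≤ κ * η) →
        (∀ c ∈ T, ∀ c' ∈ T, dist (G.wordMap c 0) (G.wordMap c' 0) ≤ τ) →
          (T.card : ℝ) ≤ C * (τ / η) ^ G.HD.toReal := by
  obtain ⟨C, hC, hcount⟩ := exists_forall_card_le_of_isAntichain_of_dist_le hirr hG hHD
  obtain ⟨m, hm, hanti⟩ := hG.exists_isAntichain_filter_length_mod hκ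
  refine ⟨m * C ^ G.HD.toReal, by positivity, fun a η τ T hη hητ hT hlen hdist => ?_⟩
  have hwords : ∀ c ∈ (T : Set (List A)), c ≠ [] ∧ c.IsChain B := fun c hc => by
    obtain ⟨v, rfl⟩ := exists_cons_mem_wordsFrom (hT hc)
    exact ⟨List.cons_ne_nil _ _, (hT hc).1⟩
  have hfiber (i : ℕ) : (({c ∈ T | c.length % m = i} : Finset (List A)).card : ℝ) ≤
      (C * (τ / η)) ^ G.HD.toReal := by
    have hsub := T.filter_subset fun c => c.length % m = i
    refine hcount a η τ _ hη hητ ((Finset.coe_subset.2 hsub).trans hT) ?_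
      (fun c hc => (hlen c (hsub hc)).1) fun c hc c' hc' => hdist c (hsub hc) c' (hsub hc')
    rw [Finset.coe_filter]
    exact hanti hη hwords hlen i
  calc (T.card : ℝ)
      = ∑ i ∈ Finset.range m, (({c ∈ T | c.length % m = i} : Finset (List A)).card : ℝ) := by
        exact_mod_cast Finset.card_eq_sum_card_fiberwise fun c _ =>
          Finset.mem_coe.2 (Finset.mem_range.2 (Nat.mod_lt _ hm))
    _ ≤ ∑ _i ∈ Finset.range m, (C * (τ / η)) ^ G.HD.toReal :=
      Finset.sum_le_sum fun i _ => hfiber i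
    _ = m * C ^ G.HD.toReal * (τ / η) ^ G.HD.toReal := by
      have hτ := hη.trans_le hητ
      rw [Finset.sum_const, Finset.card_range, nsmul_eq_mul, Real.mul_rpow hC.le (by positivity),
        mul_assoc]

end ComparableLengths

section WordCounts

variable {A : Type*} {B : A → A → Prop} {r : ℝ≥0∞} {G : ExpandingMap B r} {θ : ℝ≥0} {D δ : ℝ}

theorem le_len_of_mem_words (hG : G.UniformBounds θ D δ) {c₀ ρ : ℝ} {a : A} {c : List A}
    (hc : c ∈ G.words c₀ a ρ) : c₀⁻¹ * ρ / D ≤ G.len c :=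
  (div_le_iff₀' hG.pos).2 (hc.2.2.1.trans (hG.diam_le_mul_len hc.1))

theorem len_le_of_mem_words (hG : G.UniformBounds θ D δ) {c₀ ρ : ℝ} {a : A} {c : List A}
    (hc : c ∈ G.words c₀ a ρ) : G.len c ≤ c₀ * ρ :=
  (hG.len_le_diam hc.1).trans hc.2.2.2

theorem dist_le_of_mem_words (hG : G.UniformBounds θ D δ) {c₀ ρ : ℝ} {a : A} {c : List A}
    (hc : c ∈ G.words c₀ a ρ) {x : ℝ} (hx : x ∈ G.wordInterval c) :
    dist x (G.wordMap c 0) ≤ c₀ * ρ :=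
  (Metric.dist_le_diam_of_mem
    (isCompact_Icc.image_of_continuousOn (hG.lipschitzOnWith c hc.1).continuousOn).isBounded hx
    (mem_image_of_mem _ unitInterval.zero_mem)).trans hc.2.2.2

variable [Finite A]

theorem finite_words (hG : G.UniformBounds θ D δ) {c₀ ρ : ℝ} (hc₀ : 0 < c₀) (hρ : 0 < ρ) (a : A) :
    (G.words c₀ a ρ).Finite := by
  have hD := hG.pos
  exact (hG.finite_setOf_le_len (η := c₀⁻¹ * ρ / D) (by positivity)).subset fun _ hc =>
    ⟨hc.1, hG.le_len_of_mem_words hc⟩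

theorem exists_forall_card_words_le_of_dist_le (hirr : IsIrreducibleTransition B)
    (hG : G.UniformBounds θ D δ) (hHD : G.HD ≠ ⊤) {c₀ : ℝ} (hc₀ : 1 ≤ c₀) :
    ∃ C, 0 < C ∧ ∀ (a : A) (ρ τ : ℝ) (T : Finset (List A)), 0 < ρ → ρ ≤ τ → ↑T ⊆ G.words c₀ a ρ →
      (∀ c ∈ T, ∀ c' ∈ T, dist (G.wordMap c 0) (G.wordMap c' 0) ≤ τ) →
        (T.card : ℝ) ≤ C * (τ / ρ) ^ G.HD.toReal := by
  have hD := hG.one_le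
  have hcD : 0 < c₀ * D := by positivity
  obtain ⟨C, hC, hcount⟩ := exists_forall_card_le_of_dist_le hirr hG hHD
    (κ := c₀ ^ 2 * D) (by positivity)
  refine ⟨C * (c₀ * D) ^ G.HD.toReal, by positivity, fun a ρ τ T hρ hρτ hT hdist => ?_⟩
  have hτ := hρ.trans_le hρτ
  have hη : c₀⁻¹ * ρ / D ≤ τ := by
    rw [div_le_iff₀' (by positivity), inv_mul_le_iff₀ (by positivity), ← mul_assoc]
    exact hρτ.trans (le_mul_of_one_le_left hτ.le (one_le_mul_of_one_le_of_one_le hc₀ hD))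
  have h := hcount a (c₀⁻¹ * ρ / D) τ T (by positivity) hη
    (fun c hc => ⟨(hT hc).1, (hT hc).2.1⟩)
    (fun c hc => ⟨hG.le_len_of_mem_words (hT hc), (hG.len_le_of_mem_words (hT hc)).trans_eq ?_⟩)
    hdist
  · rwa [show τ / (c₀⁻¹ * ρ / D) = c₀ * D * (τ / ρ) by field_simp,
      Real.mul_rpow hcD.le (by positivity), ← mul_assoc] at h
  · field_simp

end WordCounts

end ExpandingMap.UniformBounds

section Slabs

theorem abs_le_of_abs_sub_mul_le {s u v w R : ℝ} (hs : s ∈ Icc (-R) R) (h : |u - s * v| ≤ w) :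
    |u| ≤ w + R * |v| :=
  calc |u| ≤ |u - s * v| + |s * v| := by simpa using abs_add_le (u - s * v) (s * v)
    _ ≤ w + R * |v| := by
      rw [abs_mul]
      gcongr
      exact abs_le.2 hs

theorem volume_real_setOf_abs_sub_mul_le {v w : ℝ} (hv : 0 < |v|) (hw : 0 ≤ w) (u : ℝ) (I : Set ℝ) :
    volume.real {s ∈ I | |u - s * v| ≤ w} ≤ 2 * (w / |v|) := by
  rw [← Real.volume_real_closedBall (div_nonneg hw hv.le) (a := u / v)]
  refine measureReal_mono (fun s hs => ?_) measure_closedBall_lt_top.ne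
  rw [Metric.mem_closedBall, Real.dist_eq, le_div_iff₀ hv, ← abs_mul, sub_mul,
    div_mul_cancel₀ _ (abs_pos.1 hv), abs_sub_comm]
  exact hs.2

/-- The exponent `k` is that of the dyadic scale `2 ^ k * w` of `v`. -/
theorem exists_volume_real_slab_le {u v w R : ℝ} (hw : 0 < w) (hR : 0 ≤ R)
    (hne : {s ∈ Icc (-R) R | |u - s * v| ≤ w}.Nonempty) :
    ∃ k : ℕ, |u| ≤ (1 + R) * (2 ^ k * w) ∧ |v| ≤ 2 ^ k * w ∧
      volume.real {s ∈ Icc (-R) R | |u - s * v| ≤ w} ≤ (2 * R + 4) * (1 / 2) ^ k := by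
  classical
  obtain ⟨s, hs, hsu⟩ := hne
  have hex : ∃ k : ℕ, |v| ≤ 2 ^ k * w := by
    obtain ⟨k, hk⟩ := pow_unbounded_of_one_lt (|v| / w) one_lt_two
    exact ⟨k, ((div_lt_iff₀ hw).1 hk).le⟩
  have hk := Nat.find_spec hex
  refine ⟨Nat.find hex, ?_, hk, ?_⟩
  · calc |u| ≤ w + R * |v| := abs_le_of_abs_sub_mul_le hs hsu
      _ ≤ 2 ^ Nat.find hex * w + R * (2 ^ Nat.find hex * w) := by
        gcongr
        exact le_mul_of_one_le_left hw.le (one_le_pow₀ one_le_two)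
      _ = (1 + R) * (2 ^ Nat.find hex * w) := by ring
  rcases hj : Nat.find hex with _ | j
  · refine (measureReal_mono (sep_subset _ _) measure_Icc_lt_top.ne).trans ?_
    rw [Real.volume_real_Icc_of_le (by linarith), pow_zero]
    linarith
  · have hlt : 2 ^ j * w < |v| := not_le.1 (Nat.find_min hex (hj ▸ j.lt_succ_self))
    have hv : 0 < |v| := lt_trans (by positivity) hlt
    calc volume.real {s ∈ Icc (-R) R | |u - s * v| ≤ w}
        ≤ 2 * (w / |v|) := volume_real_setOf_abs_sub_mul_le hv hw.le u _
      _ ≤ 2 * (w / (2 ^ j * w)) := by gcongr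
      _ = 4 * (1 / 2) ^ (j + 1) := by
        rw [pow_succ, one_div, inv_pow]
        field_simp
        norm_num
      _ ≤ (2 * R + 4) * (1 / 2) ^ (j + 1) := by
        gcongr
        linarith

end Slabs

section Summation

theorem sum_pow_le_of_card_fiber_le {ι : Type*} (P : Finset ι) (k : ι → ℕ) {q β M : ℝ}
    (hq : 0 ≤ q) (hβ : 0 ≤ β) (hqβ : β * q < 1)
    (hcard : ∀ n, (({p ∈ P | k p = n} : Finset ι).card : ℝ) ≤ M * β ^ n) :
    ∑ p ∈ P, q ^ k p ≤ M * (1 - β * q)⁻¹ := by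
  have hM : 0 ≤ M := by simpa using (Nat.cast_nonneg _).trans (hcard 0)
  calc ∑ p ∈ P, q ^ k p
      = ∑ n ∈ P.image k, (({p ∈ P | k p = n} : Finset ι).card : ℝ) * q ^ n := by
        rw [← Finset.sum_fiberwise_of_maps_to fun p hp => Finset.mem_image_of_mem k hp]
        refine Finset.sum_congr rfl fun n _ => ?_
        rw [Finset.sum_congr rfl fun p hp => by rw [(Finset.mem_filter.1 hp).2], Finset.sum_const,
          nsmul_eq_mul]
    _ ≤ ∑ n ∈ P.image k, M * (β * q) ^ n := by
        refine Finset.sum_le_sum fun n _ => ?_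
        rw [mul_pow, ← mul_assoc]
        gcongr
        exact hcard n
    _ ≤ M * (1 - β * q)⁻¹ := by
        rw [← Finset.mul_sum, ← tsum_geometric_of_lt_one (by positivity) hqβ]
        gcongr
        exact (summable_geometric_of_lt_one (by positivity) hqβ).sum_le_tsum _
          fun _ _ => by positivity

/-- The finite family of points `X i`, `i ∈ S`, is regular of dimension `d` from above at the scales
`τ ≥ ρ`: at most `C (τ / ρ)ᵈ` of its points lie at distance at most `τ` from a given one. -/
def IsUpperRegular {ι : Type*} (C d ρ : ℝ) (S : Finset ι) (X : ι → ℝ) : Prop :=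
  ∀ i ∈ S, ∀ τ, ρ ≤ τ → (({j ∈ S | |X i - X j| ≤ τ} : Finset ι).card : ℝ) ≤ C * (τ / ρ) ^ d

variable {ι ι' : Type*} {S : Finset ι} {S' : Finset ι'} {X : ι → ℝ} {Y : ι' → ℝ}
  {C C' d d' ρ : ℝ}

theorem card_close_pairs_le (hX : IsUpperRegular C d ρ S X) (hY : IsUpperRegular C' d' ρ S' Y)
    {τ τ' : ℝ} (hτ : ρ ≤ τ) (hτ' : ρ ≤ τ') :
    (({p ∈ (S ×ˢ S') ×ˢ (S ×ˢ S') |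
        |X p.1.1 - X p.2.1| ≤ τ ∧ |Y p.1.2 - Y p.2.2| ≤ τ'} : Finset _).card : ℝ) ≤
      S.card * S'.card * (C * (τ / ρ) ^ d * (C' * (τ' / ρ) ^ d')) := by
  rw [Finset.card_filter, Finset.sum_product, Nat.cast_sum, ← Nat.cast_mul, ← Finset.card_product,
    ← nsmul_eq_mul]
  refine Finset.sum_le_card_nsmul _ _ _ fun q hq => ?_
  obtain ⟨hq, hq'⟩ := Finset.mem_product.1 hq
  rw [← Finset.card_filter, Finset.filter_product (fun j => |X q.1 - X j| ≤ τ)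
    (fun j => |Y q.2 - Y j| ≤ τ'), Finset.card_product, Nat.cast_mul]
  exact mul_le_mul (hX _ hq _ hτ) (hY _ hq' _ hτ') (Nat.cast_nonneg _)
    ((Nat.cast_nonneg _).trans (hX _ hq _ hτ))

theorem card_close_pairs_dyadic_le (hX : IsUpperRegular C d ρ S X)
    (hY : IsUpperRegular C' d' ρ S' Y) (hρ : 0 < ρ) {E R : ℝ} (hE : 1 ≤ E) (hR : 0 ≤ R) (n : ℕ) :
    (({p ∈ (S ×ˢ S') ×ˢ (S ×ˢ S') | |X p.1.1 - X p.2.1| ≤ (1 + R) * (2 ^ n * (E * ρ)) ∧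
        |Y p.1.2 - Y p.2.2| ≤ 2 ^ n * (E * ρ)} : Finset _).card : ℝ) ≤
      S.card * S'.card * (C * C' * (((1 + R) * E) ^ d * E ^ d')) * (2 ^ (d + d')) ^ n := by
  have hEρ : ρ ≤ 2 ^ n * (E * ρ) := by
    rw [← mul_assoc]
    exact le_mul_of_one_le_left hρ.le
      (one_le_mul_of_one_le_of_one_le (one_le_pow₀ one_le_two) hE)
  have hREρ : ρ ≤ (1 + R) * (2 ^ n * (E * ρ)) :=
    hEρ.trans (le_mul_of_one_le_left (by positivity) (by linarith))
  refine (card_close_pairs_le hX hY hREρ hEρ).trans_eq ?_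
  have hx : ((1 + R) * (2 ^ n * (E * ρ)) / ρ) ^ d = ((1 + R) * E) ^ d * (2 ^ d) ^ n := by
    rw [show (1 + R) * (2 ^ n * (E * ρ)) / ρ = (1 + R) * E * 2 ^ n by field_simp,
      Real.mul_rpow (by positivity) (by positivity), Real.rpow_pow_comm two_pos.le]
  have hy : (2 ^ n * (E * ρ) / ρ) ^ d' = E ^ d' * (2 ^ d') ^ n := by
    rw [show 2 ^ n * (E * ρ) / ρ = E * 2 ^ n by field_simp,
      Real.mul_rpow (by positivity) (by positivity), Real.rpow_pow_comm two_pos.le]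
  rw [hx, hy, Real.rpow_add two_pos, mul_pow]
  ring

theorem sum_volume_real_slab_le (hX : IsUpperRegular C d ρ S X) (hY : IsUpperRegular C' d' ρ S' Y)
    (hd : d + d' < 1) (hρ : 0 < ρ) {E R : ℝ} (hE : 1 ≤ E) (hR : 0 ≤ R) :
    ∑ p ∈ (S ×ˢ S') ×ˢ (S ×ˢ S'), volume.real {s ∈ Icc (-R) R |
        |(X p.1.1 - X p.2.1) - s * (Y p.1.2 - Y p.2.2)| ≤ E * ρ} ≤
      (2 * R + 4) * (S.card * S'.card * (C * C' * (((1 + R) * E) ^ d * E ^ d')) *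
        (1 - 2 ^ (d + d') * (1 / 2))⁻¹) := by
  classical
  let slab (p : (ι × ι') × ι × ι') : Set ℝ :=
    {s ∈ Icc (-R) R | |(X p.1.1 - X p.2.1) - s * (Y p.1.2 - Y p.2.2)| ≤ E * ρ}
  let P := {p ∈ (S ×ˢ S') ×ˢ (S ×ˢ S') | (slab p).Nonempty}
  have hdyadic (p : P) :=
    exists_volume_real_slab_le (show 0 < E * ρ by positivity) hR (Finset.mem_filter.1 p.2).2
  choose k hkX hkY hvol using hdyadic
  have hfiber (n : ℕ) : (({p ∈ P.attach | k p = n} : Finset P).card : ℝ) ≤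
      S.card * S'.card * (C * C' * (((1 + R) * E) ^ d * E ^ d')) * (2 ^ (d + d')) ^ n := by
    refine le_trans ?_ (card_close_pairs_dyadic_le hX hY hρ hE hR n)
    rw [Nat.cast_le]
    refine Finset.card_le_card_of_injOn (↑) (fun p hp => ?_) Subtype.coe_injective.injOn
    obtain rfl := (Finset.mem_filter.1 hp).2
    exact Finset.mem_filter.2 ⟨(Finset.mem_filter.1 p.2).1, hkX p, hkY p⟩
  have hq : (2 : ℝ) ^ (d + d') * (1 / 2) < 1 := by
    have := Real.rpow_lt_rpow_of_exponent_lt one_lt_two hd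
    rw [Real.rpow_one] at this
    linarith
  calc ∑ p ∈ (S ×ˢ S') ×ˢ (S ×ˢ S'), volume.real (slab p)
      = ∑ p ∈ P, volume.real (slab p) := by
        refine (Finset.sum_filter_of_ne fun p _ hp => ?_).symm
        by_contra hempty
        exact hp (by rw [not_nonempty_iff_eq_empty.1 hempty, measureReal_empty])
    _ = ∑ p ∈ P.attach, volume.real (slab p) := (Finset.sum_attach P _).symm
    _ ≤ ∑ p ∈ P.attach, (2 * R + 4) * (1 / 2) ^ k p := Finset.sum_le_sum fun p _ => hvol p
    _ = (2 * R + 4) * ∑ p ∈ P.attach, (1 / 2) ^ k p := (Finset.mul_sum ..).symm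
    _ ≤ _ := by
        gcongr
        exact sum_pow_le_of_card_fiber_le _ k (by norm_num) (by positivity) hq hfiber

end Summation

section EmbeddedWords

variable {A : Type*} [Finite A] {B : A → A → Prop} {r : ℝ≥0∞} {G : ExpandingMap B r}
  {θ : ℝ≥0} {D δ : ℝ}

namespace ExpandingMap.UniformBounds

theorem exists_isUpperRegular_words (hirr : IsIrreducibleTransition B)
    (hG : G.UniformBounds θ D δ) (hHD : G.HD ≠ ⊤) {c₀ : ℝ} (hc₀ : 1 ≤ c₀) {h : ℝ → ℝ} {M : ℝ≥0}
    (hh : AntilipschitzWith M ((Icc 0 1).domRestrict h)) :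
    ∃ C, 0 < C ∧ ∀ (a : A) (ρ : ℝ) (T : Finset (List A)), 0 < ρ → ↑T ⊆ G.words c₀ a ρ →
      IsUpperRegular C G.HD.toReal ρ T fun c => h (G.wordMap c 0) := by
  obtain ⟨C, hC, hcount⟩ := exists_forall_card_words_le_of_dist_le hirr hG hHD hc₀
  refine ⟨C * (2 * M + 1) ^ G.HD.toReal, by positivity, fun a ρ T hρ hT c hc τ hρτ => ?_⟩
  have hτ := hρ.trans_le hρτ
  have hmem (e : List A) (he : e ∈ T) : G.wordMap e 0 ∈ Icc (0 : ℝ) 1 :=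
    G.mapsTo_wordMap (hT he).1 unitInterval.zero_mem
  set S := {e ∈ T | |h (G.wordMap c 0) - h (G.wordMap e 0)| ≤ τ}
  have hdist (e : List A) (he : e ∈ S) : dist (G.wordMap c 0) (G.wordMap e 0) ≤ M * τ := by
    obtain ⟨heT, heτ⟩ := Finset.mem_filter.1 he
    exact (hh.le_mul_dist ⟨_, hmem c hc⟩ ⟨_, hmem e heT⟩).trans (by gcongr; exact heτ)
  rw [mul_assoc, ← Real.mul_rpow (by positivity) (by positivity), ← mul_div_assoc]
  refine hcount a ρ _ S hρ ?_ ((Finset.coe_subset.2 (T.filter_subset _)).trans hT) ?_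
  · exact hρτ.trans (le_mul_of_one_le_left hτ.le (by simp))
  · intro e he e' he'
    calc dist (G.wordMap e 0) (G.wordMap e' 0)
        ≤ dist (G.wordMap c 0) (G.wordMap e 0) + dist (G.wordMap c 0) (G.wordMap e' 0) :=
          dist_triangle_left ..
      _ ≤ M * τ + M * τ := add_le_add (hdist e he) (hdist e' he')
      _ ≤ (2 * M + 1) * τ := by linarith

theorem exists_forall_card_words_le (hirr : IsIrreducibleTransition B)
    (hG : G.UniformBounds θ D δ) (hHD : G.HD ≠ ⊤) {c₀ : ℝ} (hc₀ : 1 ≤ c₀) :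
    ∃ C, 0 < C ∧ ∀ (a : A) (ρ : ℝ) (T : Finset (List A)), 0 < ρ → ρ ≤ 1 → ↑T ⊆ G.words c₀ a ρ →
      (T.card : ℝ) ≤ C * ρ ^ (-G.HD.toReal) := by
  obtain ⟨C, hC, hcount⟩ := exists_forall_card_words_le_of_dist_le hirr hG hHD hc₀
  refine ⟨C, hC, fun a ρ T hρ hρ1 hT => ?_⟩
  have hmem (e : List A) (he : e ∈ T) : G.wordMap e 0 ∈ Icc (0 : ℝ) 1 :=
    G.mapsTo_wordMap (hT he).1 unitInterval.zero_mem
  rw [Real.rpow_neg hρ.le, ← Real.inv_rpow hρ.le, ← one_div]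
  refine hcount a ρ 1 T hρ hρ1 hT fun e he e' he' => ?_
  simpa using Real.dist_le_of_mem_Icc (hmem e he) (hmem e' he')

end ExpandingMap.UniformBounds

end EmbeddedWords

section MeetingParameters

/-- The parameters `s` for which the images by `π_s` of two planar sets intersect. -/
def meetingParams (P Q : Set (ℝ × ℝ)) : Set ℝ :=
  {s | (proj s '' P ∩ proj s '' Q).Nonempty}

theorem isClosed_meetingParams {P Q : Set (ℝ × ℝ)} (hP : IsCompact P) (hQ : IsCompact Q) :
    IsClosed (meetingParams P Q) := by
  have : CompactSpace ↥(P ×ˢ Q) := isCompact_iff_compactSpace.1 (hP.prod hQ)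
  have hcl : IsClosed {z : ℝ × ↥(P ×ˢ Q) | proj z.1 z.2.1.1 = proj z.1 z.2.1.2} := by
    unfold proj
    exact isClosed_eq (by fun_prop) (by fun_prop)
  convert! isClosedMap_fst_of_compactSpace _ hcl
  ext s
  constructor
  · rintro ⟨_, ⟨x, hx, rfl⟩, y, hy, hxy⟩
    exact ⟨(s, ⟨(x, y), hx, hy⟩), hxy.symm, rfl⟩
  · rintro ⟨⟨_, ⟨⟨x, y⟩, hx, hy⟩⟩, hxy, rfl⟩
    exact ⟨_, ⟨x, hx, rfl⟩, y, hy, hxy.symm⟩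

theorem abs_sub_le_of_mem_meetingParams {P Q : Set (ℝ × ℝ)} {x y : ℝ × ℝ} {s R ε ε' : ℝ}
    (hs : |s| ≤ R) (hP : P ⊆ Metric.closedBall x.1 ε ×ˢ Metric.closedBall x.2 ε')
    (hQ : Q ⊆ Metric.closedBall y.1 ε ×ˢ Metric.closedBall y.2 ε') (h : s ∈ meetingParams P Q) :
    |(x.1 - y.1) - s * (x.2 - y.2)| ≤ 2 * ε + 2 * R * ε' := by
  obtain ⟨_, ⟨p, hp, rfl⟩, q, hq, hpq⟩ := h
  obtain ⟨hp₁, hp₂⟩ := hP hp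
  obtain ⟨hq₁, hq₂⟩ := hQ hq
  rw [Metric.mem_closedBall, Real.dist_eq] at hp₁ hp₂ hq₁ hq₂
  have hmul {t : ℝ} (ht : |t| ≤ ε') : |s * t| ≤ R * ε' := by
    rw [abs_mul]
    exact mul_le_mul hs ht (abs_nonneg _) ((abs_nonneg _).trans hs)
  have hsp := abs_le.1 (hmul hp₂)
  have hsq := abs_le.1 (hmul hq₂)
  rw [abs_le] at hp₁ hq₁ ⊢
  simp only [proj] at hpq
  constructor <;> linarith

end MeetingParameters

section CountingIntegral

variable {α ι : Type*} {P : Finset ι} {Z : ι → Set α} [∀ s, DecidablePred fun p => s ∈ Z p]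

theorem card_filter_mem_eq_sum_indicator (s : α) :
    (({p ∈ P | s ∈ Z p} : Finset ι).card : ℝ) = ∑ p ∈ P, (Z p).indicator 1 s := by
  rw [Finset.card_filter, Nat.cast_sum]
  exact Finset.sum_congr rfl fun p _ => by simp [indicator_apply]

variable [MeasurableSpace α] {μ : Measure α} [IsFiniteMeasure μ]

theorem integrable_card_filter_mem (hZ : ∀ p ∈ P, MeasurableSet (Z p)) :
    Integrable (fun s => (({p ∈ P | s ∈ Z p} : Finset ι).card : ℝ)) μ := by
  simp only [card_filter_mem_eq_sum_indicator]
  exact integrable_finsetSum _ fun p hp => (integrable_const (1 : ℝ)).indicator (hZ p hp)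

theorem integral_card_filter_mem (hZ : ∀ p ∈ P, MeasurableSet (Z p)) :
    ∫ s, (({p ∈ P | s ∈ Z p} : Finset ι).card : ℝ) ∂μ = ∑ p ∈ P, μ.real (Z p) := by
  simp only [card_filter_mem_eq_sum_indicator]
  rw [integral_finsetSum _ fun p hp => (integrable_indicator_iff (hZ p hp)).2 integrableOn_const]
  exact Finset.sum_congr rfl fun p hp => integral_indicator_one (hZ p hp)

end CountingIntegral

section Overlaps

variable {A A' : Type*} {B : A → A → Prop} {B' : A' → A' → Prop} {r r' : ℝ≥0∞}
  {G : ExpandingMap B r} {G' : ExpandingMap B' r'} {c₀ ρ : ℝ} {a : A} {a' : A'} {h h' : ℝ → ℝ}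
  {S : Finset (List A)} {S' : Finset (List A')}

open Classical in
theorem overlaps_eq_coe_filter (hS : ↑S = G.words c₀ a ρ) (hS' : ↑S' = G'.words c₀ a' ρ) (s : ℝ) :
    overlaps G G' c₀ a a' h h' ρ s = (({p ∈ (S ×ˢ S') ×ˢ (S ×ˢ S') |
      s ∈ meetingParams (rect G G' h h' p.1) (rect G G' h h' p.2)} : Finset _) : Set _) := by
  have hmem (q : List A × List A') : q ∈ rectangles G G' c₀ a a' ρ ↔ q ∈ S ×ˢ S' := by
    rw [rectangles, ← hS, ← hS', ← Finset.coe_product, Finset.mem_coe]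
  ext p
  rw [Finset.mem_coe, Finset.mem_filter, Finset.mem_product, and_assoc, ← hmem, ← hmem]
  rfl

variable {θ θ' : ℝ≥0} {D δ D' δ' : ℝ} {L L' : ℝ≥0}

theorem ExpandingMap.UniformBounds.image_wordInterval_subset_closedBall
    (hG : G.UniformBounds θ D δ) (hh : LipschitzOnWith L h (Icc 0 1)) {c : List A}
    (hc : c ∈ G.words c₀ a ρ) :
    h '' G.wordInterval c ⊆ Metric.closedBall (h (G.wordMap c 0)) (L * (c₀ * ρ)) := by
  rintro _ ⟨x, hx, rfl⟩
  have hsub := (G.mapsTo_wordMap hc.1).image_subset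
  calc dist (h x) (h (G.wordMap c 0))
      ≤ L * dist x (G.wordMap c 0) :=
        hh.dist_le_mul _ (hsub hx) _ (hsub (mem_image_of_mem _ unitInterval.zero_mem))
    _ ≤ L * (c₀ * ρ) := by
        gcongr
        exact hG.dist_le_of_mem_words hc hx

theorem ExpandingMap.UniformBounds.isCompact_image_wordInterval
    (hG : G.UniformBounds θ D δ) (hh : ContinuousOn h (Icc 0 1)) {c : List A} (hc : c.IsChain B) :
    IsCompact (h '' G.wordInterval c) :=
  (isCompact_Icc.image_of_continuousOn (hG.lipschitzOnWith c hc).continuousOn).image_of_continuousOn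
    (hh.mono (G.mapsTo_wordMap hc).image_subset)

theorem intervalIntegrable_N_and_integral_N_le (hG : G.UniformBounds θ D δ)
    (hG' : G'.UniformBounds θ' D' δ') (hh : LipschitzOnWith L h (Icc 0 1))
    (hh' : LipschitzOnWith L' h' (Icc 0 1)) (hS : ↑S = G.words c₀ a ρ)
    (hS' : ↑S' = G'.words c₀ a' ρ) {R : ℝ} (hR : 0 ≤ R) :
    IntervalIntegrable (fun s => (N G G' c₀ a a' h h' ρ s : ℝ)) volume (-R) R ∧
      ∫ s in (-R)..R, (N G G' c₀ a a' h h' ρ s : ℝ) ≤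
        ∑ p ∈ (S ×ˢ S') ×ˢ (S ×ˢ S'), volume.real {s ∈ Icc (-R) R |
          |(h (G.wordMap p.1.1 0) - h (G.wordMap p.2.1 0)) -
            s * (h' (G'.wordMap p.1.2 0) - h' (G'.wordMap p.2.2 0))| ≤
              (2 * (L * c₀) + 2 * R * (L' * c₀)) * ρ} := by
  classical
  let Z (p : (List A × List A') × List A × List A') : Set ℝ :=
    meetingParams (rect G G' h h' p.1) (rect G G' h h' p.2)
  have hmem {q : List A × List A'} (hq : q ∈ S ×ˢ S') :
      q.1 ∈ G.words c₀ a ρ ∧ q.2 ∈ G'.words c₀ a' ρ := by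
    rwa [← hS, ← hS', Finset.mem_coe, Finset.mem_coe, ← Finset.mem_product]
  have hcompact {q : List A × List A'} (hq : q ∈ S ×ˢ S') : IsCompact (rect G G' h h' q) :=
    (hG.isCompact_image_wordInterval hh.continuousOn (hmem hq).1.1).prod
      (hG'.isCompact_image_wordInterval hh'.continuousOn (hmem hq).2.1)
  have hZ : ∀ p ∈ (S ×ˢ S') ×ˢ (S ×ˢ S'), MeasurableSet (Z p) := fun p hp =>
    have hp := Finset.mem_product.1 hp
    (isClosed_meetingParams (hcompact hp.1) (hcompact hp.2)).measurableSet
  have hball {q : List A × List A'} (hq : q ∈ S ×ˢ S') :=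
    prod_mono (hG.image_wordInterval_subset_closedBall hh (hmem hq).1)
      (hG'.image_wordInterval_subset_closedBall hh' (hmem hq).2)
  have hRR : -R ≤ R := by linarith
  simp only [N, overlaps_eq_coe_filter hS hS', ncard_coe_finset]
  rw [intervalIntegrable_iff_integrableOn_Ioc_of_le hRR, intervalIntegral.integral_of_le hRR]
  refine ⟨integrable_card_filter_mem hZ, ?_⟩
  rw [integral_card_filter_mem hZ]
  refine Finset.sum_le_sum fun p hp => ?_
  rw [measureReal_restrict_apply (hZ p hp)]
  refine measureReal_mono ?_
    (measure_ne_top_of_subset (sep_subset _ _) (measure_Icc_lt_top (a := -R) (b := R)).ne)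
  rintro s ⟨hs, hsR⟩
  have hp := Finset.mem_product.1 hp
  have hsR := Ioc_subset_Icc_self hsR
  refine ⟨hsR, (abs_sub_le_of_mem_meetingParams (abs_le.2 hsR)
    (x := (h (G.wordMap p.1.1 0), h' (G'.wordMap p.1.2 0)))
    (y := (h (G.wordMap p.2.1 0), h' (G'.wordMap p.2.2 0))) (hball hp.1) (hball hp.2)
    hs).trans_eq ?_⟩
  ring

theorem exists_sum_volume_real_slab_words_le [Finite A] [Finite A']
    (hirr : IsIrreducibleTransition B) (hirr' : IsIrreducibleTransition B')
    (hG : G.UniformBounds θ D δ) (hG' : G'.UniformBounds θ' D' δ') (hdim : G.HD + G'.HD < 1)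
    {M M' : ℝ≥0} (hh : AntilipschitzWith M ((Icc 0 1).domRestrict h))
    (hh' : AntilipschitzWith M' ((Icc 0 1).domRestrict h')) (hc₀ : 1 ≤ c₀) (E : ℝ) {R : ℝ}
    (hR : 0 ≤ R) :
    ∃ C, ∀ (a : A) (a' : A') (ρ : ℝ) (S : Finset (List A)) (S' : Finset (List A')), 0 < ρ → ρ ≤ 1 →
      ↑S ⊆ G.words c₀ a ρ → ↑S' ⊆ G'.words c₀ a' ρ →
        ∑ p ∈ (S ×ˢ S') ×ˢ (S ×ˢ S'), volume.real {s ∈ Icc (-R) R |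
          |(h (G.wordMap p.1.1 0) - h (G.wordMap p.2.1 0)) -
            s * (h' (G'.wordMap p.1.2 0) - h' (G'.wordMap p.2.2 0))| ≤ E * ρ} ≤
              C * ρ ^ (-G.HD.toReal - G'.HD.toReal) := by
  have hHD : G.HD ≠ ⊤ := ne_top_of_lt (le_self_add.trans_lt hdim)
  have hHD' : G'.HD ≠ ⊤ := ne_top_of_lt (le_add_self.trans_lt hdim)
  have hd : G.HD.toReal + G'.HD.toReal < 1 := by
    rw [← ENNReal.toReal_add hHD hHD', ← ENNReal.toReal_one]
    exact ENNReal.toReal_strict_mono ENNReal.one_ne_top hdim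
  have hgap : 0 < 1 - (2 : ℝ) ^ (G.HD.toReal + G'.HD.toReal) * (1 / 2) := by
    have := Real.rpow_lt_rpow_of_exponent_lt one_lt_two hd
    rw [Real.rpow_one] at this
    linarith
  obtain ⟨C, hC, hreg⟩ := hG.exists_isUpperRegular_words hirr hHD hc₀ hh
  obtain ⟨C', hC', hreg'⟩ := hG'.exists_isUpperRegular_words hirr' hHD' hc₀ hh'
  obtain ⟨K, hK, hcard⟩ := hG.exists_forall_card_words_le hirr hHD hc₀
  obtain ⟨K', -, hcard'⟩ := hG'.exists_forall_card_words_le hirr' hHD' hc₀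
  have hE : 1 ≤ max E 1 := le_max_right ..
  refine ⟨(2 * R + 4) * (K * K' * (C * C' *
    (((1 + R) * max E 1) ^ G.HD.toReal * max E 1 ^ G'.HD.toReal)) *
      (1 - 2 ^ (G.HD.toReal + G'.HD.toReal) * (1 / 2))⁻¹), fun a a' ρ S S' hρ hρ1 hS hS' => ?_⟩
  have hwiden (x y : ℝ) : volume.real {s ∈ Icc (-R) R | |x - s * y| ≤ E * ρ} ≤
      volume.real {s ∈ Icc (-R) R | |x - s * y| ≤ max E 1 * ρ} :=
    measureReal_mono
      (fun s hs => ⟨hs.1, hs.2.trans (mul_le_mul_of_nonneg_right (le_max_left E 1) hρ.le)⟩)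
      (measure_ne_top_of_subset (sep_subset _ _) (measure_Icc_lt_top (a := -R) (b := R)).ne)
  refine (Finset.sum_le_sum fun p _ => hwiden _ _).trans ?_
  calc _ ≤ _ := sum_volume_real_slab_le (hreg a ρ S hρ hS) (hreg' a' ρ S' hρ hS') hd hρ hE hR
    _ ≤ (2 * R + 4) * (K * ρ ^ (-G.HD.toReal) * (K' * ρ ^ (-G'.HD.toReal)) * (C * C' *
          (((1 + R) * max E 1) ^ G.HD.toReal * max E 1 ^ G'.HD.toReal)) *
            (1 - 2 ^ (G.HD.toReal + G'.HD.toReal) * (1 / 2))⁻¹) := by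
        gcongr
        exacts [hcard a ρ S hρ hρ1 hS, hcard' a' ρ S' hρ hρ1 hS']
    _ = _ := by
        rw [sub_eq_add_neg (-G.HD.toReal), Real.rpow_add hρ]
        ring

end Overlaps

section Hypotheses

variable {A : Type*} {B : A → A → Prop}

theorem IsMixing.isIrreducibleTransition (hmix : IsMixing B) (hall : UsesAllLetters B) :
    IsIrreducibleTransition B := by
  intro a b
  have hne (e : A) : ({x : ℤ → A | x 0 = e} ∩ subshift B).Nonempty := by
    obtain ⟨x, hx, i, hi⟩ := hall e
    refine ⟨fun j => x (j + i), by simpa using hi, fun j => ?_⟩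
    have := hx (j + i)
    rwa [add_right_comm] at this
  have hopen (e : A) : letI : TopologicalSpace A := ⊥; IsOpen {x : ℤ → A | x 0 = e} := by
    let : TopologicalSpace A := ⊥
    have : DiscreteTopology A := ⟨rfl⟩
    exact (isOpen_discrete ({e} : Set A)).preimage
      (continuous_apply (A := fun _ : ℤ => A) (0 : ℤ))
  obtain ⟨n, hn⟩ := hmix _ _ (hopen a) (hopen b) (hne a) (hne b)
  obtain ⟨x, ⟨rfl, hx⟩, rfl⟩ := hn n le_rfl
  have hreach (m : ℕ) : Relation.ReflTransGen B (x 0) (x m) := by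
    induction m with
    | zero => rfl
    | succ m ih => exact_mod_cast ih.tail (hx m)
  simpa [shift] using hreach n

theorem IsC1Embedding.exists_lipschitzOnWith {h : ℝ → ℝ} (hh : IsC1Embedding h) :
    ∃ L, LipschitzOnWith L h (Icc 0 1) :=
  hh.contDiffOn.exists_lipschitzOnWith one_ne_zero (convex_Icc 0 1) isCompact_Icc

theorem IsC1Embedding.exists_antilipschitzWith {h : ℝ → ℝ} (hh : IsC1Embedding h) :
    ∃ M, AntilipschitzWith M ((Icc 0 1).domRestrict h) := by
  obtain ⟨m, hm, hle⟩ := exists_lt_forall_mul_abs_sub_le one_pos hh.contDiffOn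
    fun x hx => abs_pos.2 (hh.deriv_ne_zero x hx)
  refine ⟨⟨m⁻¹, (inv_pos.2 hm).le⟩, AntilipschitzWith.of_le_mul_dist fun x y => ?_⟩
  exact (le_inv_mul_iff₀ hm).2 (hle x x.2 y y.2)

end Hypotheses

end RegularCantor

open RegularCantor in
theorem proposition1_general {A A' : Type*} [Finite A] [Finite A']
    {B : A → A → Prop} {B' : A' → A' → Prop}
    (hirr : IsIrreducibleTransition B) (hirr' : IsIrreducibleTransition B')
    {r r' : ℝ≥0∞} (hr : 1 < r) (hr' : 1 < r')
    {G : ExpandingMap B r} {G' : ExpandingMap B' r'} (hdim : G.HD + G'.HD < 1) (a : A) (a' : A')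
    {h h' : ℝ → ℝ} {L L' M M' : ℝ≥0}
    (hh : LipschitzOnWith L h (Icc 0 1)) (hh' : LipschitzOnWith L' h' (Icc 0 1))
    (hinv : AntilipschitzWith M ((Icc 0 1).domRestrict h))
    (hinv' : AntilipschitzWith M' ((Icc 0 1).domRestrict h'))
    {c₀ : ℝ} (hc₀ : 1 ≤ c₀) {R : ℝ} (hR : 0 ≤ R) :
    ∃ C : ℝ, ∀ ρ ∈ Ioo (0 : ℝ) 1, (∀ s : ℝ, (overlaps G G' c₀ a a' h h' ρ s).Finite) ∧
      IntervalIntegrable (fun s => (N G G' c₀ a a' h h' ρ s : ℝ)) volume (-R) R ∧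
      ∫ s in (-R)..R, (N G G' c₀ a a' h h' ρ s : ℝ) ≤ C * ρ ^ (-G.HD.toReal - G'.HD.toReal) := by
  obtain ⟨θ, D, δ, hG⟩ := G.exists_uniformBounds hr
  obtain ⟨θ', D', δ', hG'⟩ := G'.exists_uniformBounds hr'
  obtain ⟨C, hC⟩ := exists_sum_volume_real_slab_words_le hirr hirr' hG hG' hdim hinv hinv' hc₀
    (2 * (L * c₀) + 2 * R * (L' * c₀)) hR
  refine ⟨C, fun ρ ⟨hρ, hρ1⟩ => ?_⟩
  have hc₀_pos := zero_lt_one.trans_le hc₀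
  obtain ⟨S, hS⟩ := (hG.finite_words hc₀_pos hρ a).exists_finset_coe
  obtain ⟨S', hS'⟩ := (hG'.finite_words hc₀_pos hρ a').exists_finset_coe
  obtain ⟨hint, hle⟩ := intervalIntegrable_N_and_integral_N_le hG hG' hh hh' hS hS' hR
  exact ⟨fun s => overlaps_eq_coe_filter hS hS' s ▸ Finset.finite_toSet _, hint,
    hle.trans (hC a a' ρ S S' hρ hρ1.le hS.subset hS'.subset)⟩

theorem proposition1 {A A' : Type*} [Finite A] [Finite A']
    (B : A → A → Prop) (B' : A' → A' → Prop)
    (hmix : RegularCantor.IsMixing B) (hmix' : RegularCantor.IsMixing B')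
    (hall : RegularCantor.UsesAllLetters B) (hall' : RegularCantor.UsesAllLetters B')
    (r r' : ℝ≥0∞) (hr : 1 < r) (hr' : 1 < r')
    (G : RegularCantor.ExpandingMap B r) (G' : RegularCantor.ExpandingMap B' r')
    (hdim : G.HD + G'.HD < 1)
    (a : A) (a' : A') (h h' : ℝ → ℝ)
    (hh : RegularCantor.IsC1Embedding h) (hh' : RegularCantor.IsC1Embedding h')
    (c₀ : ℝ) (hc₀ : 1 < c₀) (R : ℝ) (hR : 0 < R) :
    ∃ C : ℝ, ∀ ρ ∈ Set.Ioo (0 : ℝ) 1,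
      (∀ s : ℝ, (RegularCantor.overlaps G G' c₀ a a' h h' ρ s).Finite) ∧
      IntervalIntegrable
        (fun s => (RegularCantor.N G G' c₀ a a' h h' ρ s : ℝ)) MeasureTheory.volume (-R) R ∧
      ∫ s in (-R)..R, (RegularCantor.N G G' c₀ a a' h h' ρ s : ℝ)
        ≤ C * ρ ^ (-G.HD.toReal - G'.HD.toReal) := by
  obtain ⟨L, hL⟩ := hh.exists_lipschitzOnWith
  obtain ⟨L', hL'⟩ := hh'.exists_lipschitzOnWith
  obtain ⟨M, hM⟩ := hh.exists_antilipschitzWith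
  obtain ⟨M', hM'⟩ := hh'.exists_antilipschitzWith
  exact proposition1_general (hmix.isIrreducibleTransition hall)
    (hmix'.isIrreducibleTransition hall') hr hr' hdim a a' hL hL' hM hM' hc₀.le hR.le
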